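/- **Setting.** Let $\mathfrak g$ be a complex semisimple Lie algebra with Killing form $(\cdot,\cdot)$, $G$ a simply connected complex Lie group with Lie algebra $\mathfrak g$, $e\in\mathfrak g$ nilpotent, and assume that the adjoint orbit $\mathcal O=\mathrm{Ad}(G)e$ spans $\mathfrak g$. Let $G^e$ be the stabilizer of $e$. Let $\kappa:\mathcal M\to\mathcal O$ be a connected Galois cover, that is, $\mathcal M=G/H$ with $H$ an open subgroup of $G^e$ that is normal in $G^e$, and $\kappa(gH)=\mathrm{Ad}(g)e$; the Galois group $\mathcal S=G^e/H$ acts on $\mathcal M$ by $s\cdot gH=gs^{-1}H$. Let $\mathcal R=R(\mathcal M)$ be the algebra of regular functions on $\mathcal M$ (the holomorphic functions whose $G$-translates span a finite-dimensional space), with $G$ and $\mathcal S$ acting by translation and with the Poisson bracket $\{\cdot,\cdot\}$ of the lifted Kirillov–Kostant–Souriau form, normalized by $\{\phi^x,\phi^y\}=\phi^{[x,y]}$, where $\phi^x(m)=(x,\kappa(m))$ for $x\in\mathfrak g$. For $j\in\frac12\mathbb Z$ let $\mathcal R[j]=\{f\in\mathcal R: Ef=jf\}$, where $E$ is the lift to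 $\mathcal M$ of the Euler vector field $y\mapsto y$ of $\mathcal O$ (so $\mathcal R[j]=0$ for $j<0$), and let $\mathcal R[\le j]=\bigoplus_{i\le j}\mathcal R[i]$. Let $\alpha(f)=i^{2j}f$ for $f\in\mathcal R[j]$. **Perfect Dixmier algebras.** A perfect Dixmier algebra for $\mathcal M$ is an associative unital $\mathbb C$-algebra $\mathcal D$ (not assumed commutative) with the following data. (I) An increasing algebra filtration $\mathcal D=\bigcup_{j\in\frac12\mathbb N}\mathcal D_j$, $1\in\mathcal D_0$, such that $[\mathcal D_j,\mathcal D_k]\subseteq\mathcal D_{j+k-1}$ (put $\mathcal D_j=0$ for $j<0$). (II) A representation of $\mathcal S$ on $\mathcal D$ by filtered algebra automorphisms. (III) An injective Lie algebra homomorphism $x\mapsto\psi^x$ from $\mathfrak g$ to the $\mathcal S$-invariants of $\mathcal D_1$, such that the representation $a\mapsto\psi^xa-a\psi^x$ of $\mathfrak g$ on $\mathcal D$ is locally finite and exponentiates to a representation by algebra automorphisms of $G$, trivial on the elements of $G$ that act trivially on $\mathcal M$. (IV) An $\mathcal S$-equivariant isomorphism of graded Poisson algebras $\gamma:\mathrm{gr}\,\mathcal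 D\to\mathcal R$, where $\mathrm{gr}\,\mathcal D=\bigoplus_j\mathcal D_j/\mathcal D_{j-1/2}$ has the product and the Poisson bracket (of degree $-1$) induced by the product and the commutator of $\mathcal D$, such that $\gamma$ maps the class of $\psi^x$ in degree $1$ to $\phi^x$. (V) An $\mathcal S$-invariant filtered algebra anti-automorphism $\beta$ of $\mathcal D$ such that $\beta(\psi^x)=\psi^{-x}$, $\beta$ induces $\gamma^{-1}\alpha\gamma$ on $\mathrm{gr}\,\mathcal D$, and $\beta^4=1$. Let $T:\mathcal D\to\mathbb C$ be the (unique) $G$-invariant linear map with $T(1)=1$. (VI) $T$ is a supertrace for the $\mathbb Z/2$-grading of $\mathcal D$ by the $+1$ (even) and $-1$ (odd) eigenspaces of $\beta^2$: $T(ab)=(-1)^{|a||b|}T(ba)$ if $a$ and $b$ are homogeneous of the same parity, and $T(ab)=0$ if they are of different parity. (VII) The pairing $\mathcal P(a,b)=T(ab)$ is non-degenerate on $\mathcal D_j$ for each $j$. Let $\mathcal D^j$ be the $\mathcal P$-orthogonal complement of $\mathcal D_{j-1/2}$ in $\mathcal D_j$. **Proposition 4.1.** Let $\mathcal D$ be a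 perfect Dixmier algebra for $\mathcal M$. There is a unique linear map $\mathbf q:\mathcal R\to\mathcal D$ that lifts $\gamma^{-1}:\mathcal R\to\mathrm{gr}\,\mathcal D$ and satisfies $\mathbf q(\mathcal R[j])=\mathcal D^j$ for all $j$, and $\mathbf q$ is bijective. The product $$\phi\circ\psi=\mathbf q^{-1}\big((\mathbf q\phi)(\mathbf q\psi)\big)$$ on $\mathcal R$ is associative, with unit $1$, and invariant under $G\times\mathcal S$, and it is noncommutative if $\mathfrak g\ne0$. Moreover $\mathcal R=\bigoplus_j\mathcal R[j]$, and the following holds for all $j,k\in\frac12\mathbb N$, $\phi\in\mathcal R[j]$ and $\psi\in\mathcal R[k]$. 1. $\phi\circ\psi\in\mathcal R[j+k]\oplus\mathcal R[j+k-1]\oplus\cdots\oplus\mathcal R[|j-k|]$. 2. $\phi\circ\psi\equiv\phi\psi+\frac12\{\phi,\psi\}\mod\mathcal R[\le j+k-2]$. 3. If $\phi\circ\psi=\sum_{p\ge0}C_p(\phi,\psi)$ and $\psi\circ\phi=\sum_{p\ge0}C_p(\psi,\phi)$ with $C_p(\phi,\psi),C_p(\psi,\phi)\in\mathcal R[j+k-p]$,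 then $C_p(\phi,\psi)=(-1)^pC_p(\psi,\phi)$ for all $p$. -/

import Mathlib

open scoped Manifold ContDiff DirectSum

/-! ## The complex group and its adjoint action

`G` is a complex Lie group, modelled on `ℂ^d`; its Lie algebra is Mathlib's `GroupLieAlgebra`, the
tangent space at `1` with the bracket of left-invariant vector fields. -/

/-- The Lie algebra of the complex Lie group `G`. -/
abbrev LieAlg (d : ℕ) (G : Type*) [TopologicalSpace G] [ChartedSpace (EuclideanSpace ℂ (Fin d)) G]
    [Group G] : Type :=
  GroupLieAlgebra 𝓘(ℂ, EuclideanSpace ℂ (Fin d)) G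

section Group

variable {d : ℕ} {G : Type*} [TopologicalSpace G] [ChartedSpace (EuclideanSpace ℂ (Fin d)) G]
  [Group G] [LieGroup 𝓘(ℂ, EuclideanSpace ℂ (Fin d)) ω G]

/-- The adjoint action: `Ad g` is the derivative at `1` of the conjugation `x ↦ g x g⁻¹`. -/
noncomputable def Ad (g : G) (x : LieAlg d G) : LieAlg d G :=
  mfderiv 𝓘(ℂ, EuclideanSpace ℂ (Fin d)) 𝓘(ℂ, EuclideanSpace ℂ (Fin d))
    (fun y : G => g * y * g⁻¹) 1 x

theorem mdifferentiable_conj (g : G) :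
    MDifferentiable 𝓘(ℂ, EuclideanSpace ℂ (Fin d)) 𝓘(ℂ, EuclideanSpace ℂ (Fin d))
      (fun y : G => g * y * g⁻¹) := by
  have h : ContMDiff 𝓘(ℂ, EuclideanSpace ℂ (Fin d)) 𝓘(ℂ, EuclideanSpace ℂ (Fin d)) ω
      (fun y : G => g * y * g⁻¹) := (contMDiff_const.mul contMDiff_id).mul contMDiff_const
  exact h.mdifferentiable (by simp)

theorem Ad_one (x : LieAlg d G) : Ad (1 : G) x = x := by
  have h : (fun y : G => (1 : G) * y * (1 : G)⁻¹) = id := by ext y; simp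
  unfold Ad
  rw [h, mfderiv_id]
  rfl

theorem Ad_mul (g h : G) (x : LieAlg d G) : Ad (g * h) x = Ad g (Ad h x) := by
  have e : (fun y : G => (g * h) * y * (g * h)⁻¹) =
      (fun y : G => g * y * g⁻¹) ∘ (fun y : G => h * y * h⁻¹) := by
    ext y; simp [mul_assoc]
  have key : ∀ (p : G), p = 1 → ∀ v : EuclideanSpace ℂ (Fin d),
      (mfderiv 𝓘(ℂ, EuclideanSpace ℂ (Fin d)) 𝓘(ℂ, EuclideanSpace ℂ (Fin d))
        (fun y : G => g * y * g⁻¹) p v : EuclideanSpace ℂ (Fin d)) =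
      mfderiv 𝓘(ℂ, EuclideanSpace ℂ (Fin d)) 𝓘(ℂ, EuclideanSpace ℂ (Fin d))
        (fun y : G => g * y * g⁻¹) 1 v := by
    rintro p rfl v; rfl
  unfold Ad
  rw [e, mfderiv_comp (I' := 𝓘(ℂ, EuclideanSpace ℂ (Fin d))) (1 : G)
    (mdifferentiable_conj g _) (mdifferentiable_conj h _)]
  exact key (h * 1 * h⁻¹) (by simp) _

/-- The stabilizer `G^e` of `e` under the adjoint action. -/
def adStabilizer (e : LieAlg d G) : Subgroup G where
  carrier := {g | Ad g e = e}
  mul_mem' {a b} ha hb := by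
    simp only [Set.mem_ofPred_eq] at *
    rw [Ad_mul, hb, ha]
  one_mem' := Ad_one e
  inv_mem' {a} ha := by
    simp only [Set.mem_ofPred_eq] at *
    conv_lhs => rw [← ha]
    rw [← Ad_mul, inv_mul_cancel, Ad_one]

end Group

/-! ## Galois covers of nilpotent orbits -/

/-- A nilpotent orbit `O = Ad(G) e` spanning the Lie algebra of `G`, together with a connected
Galois cover of it. For `G` connected and simply connected, the connected covers of `O = G / G^e`
are the homogeneous spaces `M = G / H` with `H` an open subgroup of `G^e`; `H` is the
stabilizer `G^m` of the base point `m` above `e`. The cover is Galois iff `H` is normal in `G^e`. -/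
structure GaloisOrbitCover (d : ℕ) (G : Type*) [TopologicalSpace G]
    [ChartedSpace (EuclideanSpace ℂ (Fin d)) G] [Group G]
    [LieGroup 𝓘(ℂ, EuclideanSpace ℂ (Fin d)) ω G] where
  e : LieAlg d G
  nilpotent : IsNilpotent (LieAlgebra.ad ℂ (LieAlg d G) e)
  spans : Submodule.span ℂ (Set.range fun g : G => Ad g e) = ⊤
  H : Subgroup G
  le_stabilizer : H ≤ adStabilizer e
  isOpen_in_stabilizer :
    IsOpen ((H.subgroupOf (adStabilizer e) : Subgroup (adStabilizer e)) : Set (adStabilizer e))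
  normal : (H.subgroupOf (adStabilizer e)).Normal

namespace GaloisOrbitCover

variable {d : ℕ} {G : Type*} [TopologicalSpace G] [ChartedSpace (EuclideanSpace ℂ (Fin d)) G]
  [Group G] [LieGroup 𝓘(ℂ, EuclideanSpace ℂ (Fin d)) ω G] (X : GaloisOrbitCover d G)

/-- The covering space `M = G / H`, with `G` acting by left translation. -/
abbrev M : Type _ := G ⧸ X.H

instance : (X.H.subgroupOf (adStabilizer X.e)).Normal := X.normal

/-- The Galois group `S = G^e / G^m`. -/
abbrev S : Type _ := adStabilizer X.e ⧸ X.H.subgroupOf (adStabilizer X.e)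

/-- The covering map `M → O ⊆ 𝔤`, `gH ↦ Ad(g) e`. -/
noncomputable def κ : X.M → LieAlg d G :=
  Quotient.lift (fun g : G => Ad g X.e) (by
    intro a b hab
    have h : a⁻¹ * b ∈ X.H := QuotientGroup.leftRel_apply.mp hab
    have h' : Ad (a⁻¹ * b) X.e = X.e := X.le_stabilizer h
    have : Ad b X.e = Ad a (Ad (a⁻¹ * b) X.e) := by rw [← Ad_mul]; simp
    simp only [this, h'])

/-- The map `gH ↦ g s⁻¹ H` of `M`, for `s ∈ G^e`. -/
def rightMul (s : adStabilizer X.e) : X.M → X.M :=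
  Quotient.map (fun g : G => g * (s : G)⁻¹) (by
    intro a b hab
    have h : a⁻¹ * b ∈ X.H := QuotientGroup.leftRel_apply.mp hab
    refine QuotientGroup.leftRel_apply.mpr ?_
    have h2 := X.normal.conj_mem ⟨a⁻¹ * b, X.le_stabilizer h⟩ (Subgroup.mem_subgroupOf.mpr h) s
    have h3 := Subgroup.mem_subgroupOf.mp h2
    simpa [mul_assoc] using h3)

theorem rightMul_mk (s : adStabilizer X.e) (g : G) :
    X.rightMul s (g : X.M) = ((g * (s : G)⁻¹ : G) : X.M) := rfl

/-- The action of `G^e` on `M` through `gH ↦ g s⁻¹ H`. -/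
def rightMulHom : adStabilizer X.e →* Equiv.Perm X.M where
  toFun s :=
    { toFun := X.rightMul s
      invFun := X.rightMul s⁻¹
      left_inv := by
        intro m
        induction m using QuotientGroup.induction_on with
        | H g => simp [rightMul_mk]
      right_inv := by
        intro m
        induction m using QuotientGroup.induction_on with
        | H g => simp [rightMul_mk] }
  map_one' := by
    ext m
    induction m using QuotientGroup.induction_on with
    | H g => simp [rightMul_mk]
  map_mul' s t := by
    ext m
    induction m using QuotientGroup.induction_on with
    | H g => simp [rightMul_mk, mul_assoc]

/-- The action of the Galois group `S = G^e / G^m` on `M` by deck transformations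
`s · gH = g s⁻¹ H`. -/
def deck : X.S →* Equiv.Perm X.M :=
  QuotientGroup.lift _ X.rightMulHom (by
    intro s hs
    ext m
    induction m using QuotientGroup.induction_on with
    | H g =>
      have h : (s : G) ∈ X.H := Subgroup.mem_subgroupOf.mp hs
      change X.rightMul s (g : X.M) = (g : X.M)
      rw [rightMul_mk]
      exact (QuotientGroup.eq.mpr (by simpa using h)))

theorem deck_smul (s : X.S) (g : G) (m : X.M) : X.deck s (g • m) = g • X.deck s m := by
  induction s using QuotientGroup.induction_on with
  | H s =>
    induction m using QuotientGroup.induction_on with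
    | H a =>
      change X.rightMul s ((g * a : G) : X.M) = g • X.rightMul s (a : X.M)
      rw [rightMul_mk, rightMul_mk, mul_assoc]
      rfl

/-! ## Regular functions on the cover -/

/-- Translation of functions on `M` by `g`: `(g · f)(m) = f (g⁻¹ m)`. -/
def translate (g : G) : (X.M → ℂ) →ₐ[ℂ] (X.M → ℂ) where
  toFun f m := f (g⁻¹ • m)
  map_one' := rfl
  map_mul' _ _ := rfl
  map_zero' := rfl
  map_add' _ _ := rfl
  commutes' _ := rfl

/-- The action of the Galois group on functions on `M`: `(s · f)(m) = f (s⁻¹ m)`. -/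
def deckTranslate (s : X.S) : (X.M → ℂ) →ₐ[ℂ] (X.M → ℂ) where
  toFun f m := f (X.deck s⁻¹ m)
  map_one' := rfl
  map_mul' _ _ := rfl
  map_zero' := rfl
  map_add' _ _ := rfl
  commutes' _ := rfl

/-- The span of the `G`-translates of `f`. -/
def translateSpan (f : X.M → ℂ) : Submodule ℂ (X.M → ℂ) :=
  Submodule.span ℂ (Set.range fun g : G => X.translate g f)

/-- The regular functions on the homogeneous space `M = G / H`: the algebra `ℂ[G]^H` of right
`H`-invariant regular functions on `G`. A function on the complex semisimple group `G` is regular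
(a matrix coefficient of a finite-dimensional holomorphic representation) iff it is holomorphic and
its translates span a finite-dimensional space. -/
def IsRegular (f : X.M → ℂ) : Prop :=
  MDifferentiable 𝓘(ℂ, EuclideanSpace ℂ (Fin d)) 𝓘(ℂ, ℂ) (fun g : G => f (g : X.M)) ∧
    (X.translateSpan f).FG

/-- The algebra `R = R(M)` of regular functions on `M`. -/
def R : Subalgebra ℂ (X.M → ℂ) where
  carrier := {f | X.IsRegular f}
  mul_mem' {a b} ha hb := by
    refine ⟨ha.1.mul hb.1, ?_⟩
    refine Submodule.FG.of_le (ha.2.mul hb.2) ?_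
    refine Submodule.span_le.mpr ?_
    rintro _ ⟨g, rfl⟩
    simp only [map_mul]
    exact Submodule.mul_mem_mul (Submodule.subset_span ⟨g, rfl⟩) (Submodule.subset_span ⟨g, rfl⟩)
  add_mem' {a b} ha hb := by
    refine ⟨ha.1.add hb.1, ?_⟩
    refine Submodule.FG.of_le (ha.2.sup hb.2) ?_
    refine Submodule.span_le.mpr ?_
    rintro _ ⟨g, rfl⟩
    simp only [map_add]
    exact Submodule.add_mem_sup (Submodule.subset_span ⟨g, rfl⟩) (Submodule.subset_span ⟨g, rfl⟩)
  algebraMap_mem' c := by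
    refine ⟨mdifferentiable_const, ?_⟩
    refine Submodule.FG.of_le (Submodule.fg_span_singleton (algebraMap ℂ (X.M → ℂ) c)) ?_
    refine Submodule.span_le.mpr ?_
    rintro _ ⟨g, rfl⟩
    exact Submodule.subset_span rfl

theorem translate_mem (g : G) {f : X.M → ℂ} (hf : f ∈ X.R) : X.translate g f ∈ X.R := by
  refine ⟨?_, ?_⟩
  · have h : ContMDiff 𝓘(ℂ, EuclideanSpace ℂ (Fin d)) 𝓘(ℂ, EuclideanSpace ℂ (Fin d)) ω
        (fun y : G => g⁻¹ * y) := contMDiff_mul_left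
    exact MDifferentiable.comp (g := fun y : G => f (y : X.M)) hf.1 (h.mdifferentiable (by simp))
  · refine Submodule.FG.of_le hf.2 (Submodule.span_le.mpr ?_)
    rintro _ ⟨k, rfl⟩
    refine Submodule.subset_span ⟨k * g, ?_⟩
    funext m
    change f ((k * g)⁻¹ • m) = f (g⁻¹ • k⁻¹ • m)
    rw [mul_inv_rev, mul_smul]

theorem deckTranslate_mem (s : X.S) {f : X.M → ℂ} (hf : f ∈ X.R) : X.deckTranslate s f ∈ X.R := by
  refine ⟨?_, ?_⟩
  · induction s using QuotientGroup.induction_on with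
    | H s =>
      have h : ContMDiff 𝓘(ℂ, EuclideanSpace ℂ (Fin d)) 𝓘(ℂ, EuclideanSpace ℂ (Fin d)) ω
          (fun y : G => y * ((s⁻¹ : adStabilizer X.e) : G)⁻¹) := contMDiff_mul_right
      exact MDifferentiable.comp (g := fun y : G => f (y : X.M)) hf.1 (h.mdifferentiable (by simp))
  · have h := hf.2.map (X.deckTranslate s).toLinearMap
    refine Submodule.FG.of_le h (Submodule.span_le.mpr ?_)
    rintro _ ⟨g, rfl⟩
    refine ⟨X.translate g f, Submodule.subset_span ⟨g, rfl⟩, ?_⟩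
    funext m
    change f (g⁻¹ • X.deck s⁻¹ m) = f (X.deck s⁻¹ (g⁻¹ • m))
    rw [deck_smul]

/-- The action of `G` on `R`. -/
def actG (g : G) (f : X.R) : X.R := ⟨X.translate g f, X.translate_mem g f.2⟩

/-- The action of `S` on `R`. -/
def actS (s : X.S) (f : X.R) : X.R := ⟨X.deckTranslate s f, X.deckTranslate_mem s f.2⟩

/-! ## The Hamiltonian functions, the Poisson bracket and the Euler grading -/

/-- The Hamiltonian functions `φ^x(m) = (x, κ(m))`, with `( , )` the Killing form. -/
noncomputable def φ (x : LieAlg d G) (m : X.M) : ℂ :=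
  killingForm ℂ (LieAlg d G) x (X.κ m)

/-- The derivative at `m` of `f` along the fundamental vector field `z_M` of `z ∈ 𝔤`, i.e.
`d/dt f(exp(tz) m)` at `t = 0`. The vectors `z_M(m)` exhaust the tangent space of `M` at `m`. -/
noncomputable def vderiv (z : LieAlg d G) (f : X.M → ℂ) (m : X.M) : ℂ :=
  mfderiv 𝓘(ℂ, EuclideanSpace ℂ (Fin d)) 𝓘(ℂ, ℂ) (fun g : G => f (g • m)) 1 z

/-- The lifted KKS symplectic form on `M`: `ω_m(x_M, y_M) = (κ(m), [x, y])`. -/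
noncomputable def kks (m : X.M) (x y : LieAlg d G) : ℂ :=
  killingForm ℂ (LieAlg d G) (X.κ m) ⁅x, y⁆

/-- `x_M(m)` is the Hamiltonian vector of `f` at `m`: `df_m = ω_m(x_M, ·)`. -/
def IsHamiltonianAt (f : X.M → ℂ) (m : X.M) (x : LieAlg d G) : Prop :=
  ∀ z : LieAlg d G, X.vderiv z f m = X.kks m x z

open Classical in
/-- Some `x ∈ 𝔤` such that `x_M(m)` is the Hamiltonian vector of `f` at `m`; it exists when `f` is
regular, and the vector `x_M(m)` is then unique. -/
noncomputable def hamiltonian (f : X.M → ℂ) (m : X.M) : LieAlg d G :=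
  if h : ∃ x, X.IsHamiltonianAt f m x then h.choose else 0

/-- The Poisson bracket of the KKS symplectic form, `{f₁, f₂} = ω(X_{f₁}, X_{f₂})`, so that
`{φ^x, φ^y} = φ^{[x, y]}`. -/
noncomputable def poisson (f₁ f₂ : X.M → ℂ) (m : X.M) : ℂ :=
  X.kks m (X.hamiltonian f₁ m) (X.hamiltonian f₂ m)

theorem mdifferentiable_orbit {f : X.M → ℂ} (hf : f ∈ X.R) (m : X.M) :
    MDifferentiable 𝓘(ℂ, EuclideanSpace ℂ (Fin d)) 𝓘(ℂ, ℂ) (fun g : G => f (g • m)) := by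
  induction m using QuotientGroup.induction_on with
  | H a =>
    have h : ContMDiff 𝓘(ℂ, EuclideanSpace ℂ (Fin d)) 𝓘(ℂ, EuclideanSpace ℂ (Fin d)) ω
        (fun y : G => y * a) := contMDiff_mul_right
    exact MDifferentiable.comp (g := fun y : G => f (y : X.M)) hf.1 (h.mdifferentiable (by simp))

/-- The Euler grading. All half-integral degrees are doubled: `X.gr n` is the space
`R[n/2]` of regular functions of degree `n/2`, that is, with `E f = (n/2) f` where `E` is the Euler
vector field of `M`. The latter lifts the Euler field `y ↦ y` on `O`, hence `E(m) = x_M(m)`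
for any `x ∈ 𝔤` with `[x, κ(m)] = κ(m)`. -/
noncomputable def gr (n : ℤ) : Submodule ℂ X.R where
  carrier := {f | ∀ (m : X.M) (x : LieAlg d G), ⁅x, X.κ m⁆ = X.κ m →
    X.vderiv x f m = ((n : ℂ) / 2) * (f : X.M → ℂ) m}
  zero_mem' m x _ := by
    change mfderiv _ _ (fun _ : G => (0 : ℂ)) 1 x = _
    rw [mfderiv_const]
    change (0 : ℂ) = (n : ℂ) / 2 * 0
    rw [mul_zero]
  add_mem' {a b} ha hb m x hx := by
    have h : X.vderiv x ((a + b : X.R) : X.M → ℂ) m = X.vderiv x a m + X.vderiv x b m := by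
      have := mfderiv_add (X.mdifferentiable_orbit a.2 m 1) (X.mdifferentiable_orbit b.2 m 1)
      exact DFunLike.congr_fun this x
    rw [h, ha m x hx, hb m x hx]
    simp [mul_add]
  smul_mem' c a ha m x hx := by
    have h : X.vderiv x ((c • a : X.R) : X.M → ℂ) m = c * X.vderiv x a m := by
      have := const_smul_mfderiv (X.mdifferentiable_orbit a.2 m 1) c
      exact DFunLike.congr_fun this x
    rw [h, ha m x hx]
    simp [mul_left_comm]

/-- `R[≤ n/2]`, the span of the `R[i/2]` with `i ≤ n`. -/
noncomputable def grLE (n : ℤ) : Submodule ℂ X.R := ⨆ i : {i : ℤ // i ≤ n}, X.gr i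

end GaloisOrbitCover

/-! ## Perfect Dixmier algebras -/

/-- The associated graded space `⨁ F_n / F_{n-1}` of a filtration. -/
abbrev AssocGraded {D : Type*} [Ring D] [Algebra ℂ D] (F : ℤ → Submodule ℂ D) : Type _ :=
  ⨁ n : ℤ, (F n ⧸ (F (n - 1)).submoduleOf (F n))

/-- The projection `p_n : F_n → gr_n`. -/
noncomputable def grMk {D : Type*} [Ring D] [Algebra ℂ D] (F : ℤ → Submodule ℂ D) (n : ℤ) :
    F n →ₗ[ℂ] AssocGraded F :=
  DirectSum.lof ℂ ℤ (fun n : ℤ => F n ⧸ (F (n - 1)).submoduleOf (F n)) n ∘ₗ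
    ((F (n - 1)).submoduleOf (F n)).mkQ

/-- A perfect Dixmier algebra for the Galois cover `M`. Half-integral indices are doubled: `F n` is
the filtration space `D_{n/2}`, which is `0` for `n < 0`. -/
structure PerfectDixmierAlgebra {d : ℕ} {G : Type*} [TopologicalSpace G]
    [ChartedSpace (EuclideanSpace ℂ (Fin d)) G] [Group G]
    [LieGroup 𝓘(ℂ, EuclideanSpace ℂ (Fin d)) ω G] (X : GaloisOrbitCover d G)
    (D : Type*) [Ring D] [Algebra ℂ D] where
  /-- The filtration, with `[D_j, D_k] ⊆ D_{j+k-1}`. -/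
  F : ℤ → Submodule ℂ D
  F_mono : Monotone F
  F_neg : ∀ n < 0, F n = ⊥
  F_exhaustive : ∀ a, ∃ n, a ∈ F n
  one_mem_F : 1 ∈ F 0
  mul_mem_F : ∀ m n a b, a ∈ F m → b ∈ F n → a * b ∈ F (m + n)
  commutator_mem_F : ∀ m n a b, a ∈ F m → b ∈ F n → a * b - b * a ∈ F (m + n - 2)
  /-- The action of the Galois group by filtered algebra automorphisms. -/
  σ : X.S →* (D ≃ₐ[ℂ] D)
  σ_mem_F : ∀ s n a, a ∈ F n → σ s a ∈ F n
  /-- The Lie algebra embedding into the `S`-invariants of `D_1`. -/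
  ψ : LieAlg d G →ₗ[ℂ] D
  ψ_lie : ∀ x y, ψ ⁅x, y⁆ = ψ x * ψ y - ψ y * ψ x
  ψ_injective : Function.Injective ψ
  ψ_mem_F : ∀ x, ψ x ∈ F 2
  σ_ψ : ∀ s x, σ s (ψ x) = ψ x
  /-- The action of `G` by algebra automorphisms. -/
  ρ : G →* (D ≃ₐ[ℂ] D)
  /-- `ρ` is a representation of the quotient of `G` that acts effectively on `M`. -/
  ρ_eq_one : ∀ g : G, (∀ m : X.M, g • m = m) → ρ g = 1
  /-- The `𝔤`- and `G`-actions are locally finite. -/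
  locally_finite : ∀ a, ∃ V : Submodule ℂ D, V.FG ∧ a ∈ V ∧
    (∀ x, ∀ b ∈ V, ψ x * b - b * ψ x ∈ V) ∧ (∀ g, ∀ b ∈ V, ρ g b ∈ V)
  /-- `ρ` is holomorphic; the topology on `D` is that of its finite-dimensional subspaces. -/
  ρ_holomorphic : ∀ (a : D) (l : Module.Dual ℂ D),
    MDifferentiable 𝓘(ℂ, EuclideanSpace ℂ (Fin d)) 𝓘(ℂ, ℂ) (fun g : G => l (ρ g a))
  /-- The differential of `ρ` is the `𝔤`-action by the derivations `a ↦ ψ^x a - a ψ^x`. -/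
  ρ_deriv : ∀ (a : D) (l : Module.Dual ℂ D) (x : LieAlg d G),
    mfderiv 𝓘(ℂ, EuclideanSpace ℂ (Fin d)) 𝓘(ℂ, ℂ) (fun g : G => l (ρ g a)) 1 x =
      l (ψ x * a - a * ψ x)
  /-- The `S`-equivariant isomorphism of graded Poisson algebras `gr D → R`. The product and
  the Poisson bracket of `gr D` are induced by the product and the commutator of `D`. -/
  γ : AssocGraded F ≃ₗ[ℂ] X.R
  γ_graded : ∀ n, (LinearMap.range (grMk F n)).map γ.toLinearMap = X.gr n
  γ_mul : ∀ m n (a : F m) (b : F n) (c : F (m + n)), (c : D) = a * b →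
    γ (grMk F (m + n) c) = γ (grMk F m a) * γ (grMk F n b)
  γ_poisson : ∀ m n (a : F m) (b : F n) (c : F (m + n - 2)), (c : D) = a * b - b * a →
    ((γ (grMk F (m + n - 2) c) : X.R) : X.M → ℂ) =
      X.poisson (γ (grMk F m a) : X.R) (γ (grMk F n b) : X.R)
  γ_σ : ∀ s n (a b : F n), (b : D) = σ s a → γ (grMk F n b) = X.actS s (γ (grMk F n a))
  γ_ψ : ∀ x, ((γ (grMk F 2 ⟨ψ x, ψ_mem_F x⟩) : X.R) : X.M → ℂ) = X.φ x
  /-- The `S`-invariant filtered algebra anti-automorphism. -/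
  β : D ≃ₗ[ℂ] D
  β_mul : ∀ a b, β (a * b) = β b * β a
  β_mem_F : ∀ n a, a ∈ F n → β a ∈ F n
  β_σ : ∀ s a, β (σ s a) = σ s (β a)
  β_ψ : ∀ x, β (ψ x) = ψ (-x)
  /-- `β` induces `γ⁻¹ α γ` on `gr D`, where `α f = i^{2j} f` for `f ∈ R[j]`. -/
  γ_β : ∀ n (a b : F n), (b : D) = β a →
    γ (grMk F n b) = (Complex.I ^ n) • γ (grMk F n a)
  β_four : ∀ a, β (β (β (β a))) = a
  /-- The `G`-linear map `T : D → ℂ` with `T 1 = 1`. There is exactly one, by the axioms above. -/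
  T : D →ₗ[ℂ] ℂ
  T_one : T 1 = 1
  T_ρ : ∀ g a, T (ρ g a) = T a
  /-- `T` is a supertrace for the `ℤ/2`-grading by the `±1`-eigenspaces of `β²`. -/
  T_even : ∀ a b, β (β a) = a → β (β b) = b → T (a * b) = T (b * a)
  T_odd : ∀ a b, β (β a) = -a → β (β b) = -b → T (a * b) = -T (b * a)
  T_mixed : ∀ a b, β (β a) = a → β (β b) = -b → T (a * b) = 0 ∧ T (b * a) = 0
  /-- The pairing `P(a, b) = T(ab)` is non-degenerate on each `D_j`. -/
  nondegenerate : ∀ n, ∀ a ∈ F n, (∀ b ∈ F n, T (a * b) = 0) → a = 0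

namespace PerfectDixmierAlgebra

variable {d : ℕ} {G : Type*} [TopologicalSpace G] [ChartedSpace (EuclideanSpace ℂ (Fin d)) G]
  [Group G] [LieGroup 𝓘(ℂ, EuclideanSpace ℂ (Fin d)) ω G] {X : GaloisOrbitCover d G}
  {D : Type*} [Ring D] [Algebra ℂ D] (A : PerfectDixmierAlgebra X D)

/-- The summand `D^{n/2}` of the orthogonal decomposition: the `P`-orthogonal complement of
`D_{(n-1)/2}` in `D_{n/2}`. -/
def piece (n : ℤ) : Submodule ℂ D where
  carrier := {a | a ∈ A.F n ∧ ∀ b ∈ A.F (n - 1), A.T (a * b) = 0}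
  zero_mem' := ⟨Submodule.zero_mem _, by simp⟩
  add_mem' {a b} ha hb := ⟨Submodule.add_mem _ ha.1 hb.1, fun c hc => by
    rw [add_mul, map_add, ha.2 c hc, hb.2 c hc, add_zero]⟩
  smul_mem' c a ha := ⟨Submodule.smul_mem _ c ha.1, fun b hb => by
    rw [smul_mul_assoc, map_smul, ha.2 b hb, smul_zero]⟩

/-- `q : R → D` lifts `γ⁻¹ : R → gr D`, and maps `R[j]` onto `D^j`. -/
structure IsQuantizationMap (q : X.R →ₗ[ℂ] D) : Prop where
  lifts : ∀ n, ∀ f ∈ X.gr n, ∃ h : q f ∈ A.F n, grMk A.F n ⟨q f, h⟩ = A.γ.symm f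
  maps_onto : ∀ n, (X.gr n).map q = A.piece n

end PerfectDixmierAlgebra

/-- The product `f ∘ g = q⁻¹ (q(f) q(g))` that a linear isomorphism `q : R → D` transports from
`D` to `R`. -/
def circ {R D : Type*} [AddCommGroup R] [Module ℂ R] [Ring D] [Algebra ℂ D] (q : R ≃ₗ[ℂ] D) :
    R →ₗ[ℂ] R →ₗ[ℂ] R :=
  ((LinearMap.mul ℂ D).compl₁₂ q.toLinearMap q.toLinearMap).compr₂ q.symm.toLinearMap

/-! The trace pairing `T(ab)` is the engine. If it splits `D` into the mutually orthogonal spaces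
`piece n`, then each `piece n` meets `F (n - 1)` only in `0` and surjects onto `F n / F (n - 1)`, so
taking symbols is an isomorphism `piece n ≃ X.gr n`. Its inverses assemble to the only possible `q`.
Everything about the product is then read off from `T(abc)` with `a`, `b`, `c` in pieces.

The splitting `F n = piece n ⊕ F (n - 1)` needs an argument, because in infinite dimension a
nondegenerate form need not represent every functional. It is enough to represent the pairing with
`F (n - 1)` of a finite-dimensional `G`-stable space `W` of `D`. By complete reducibility this is a
count of intertwiners (`exists_intertwiner_eq_pairing`), and it succeeds because multiplicities are
finite: an intertwiner from a representation of `G` to functions on the homogeneous space `M` is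
determined by its values at the base point (`finiteDimensional_intertwiners`). That argument needs
the symbol map to carry `[ψ^x, a]` to the derivative along a vector field, hence the existence of
Hamiltonian vectors (`hasHamiltonianAt`).

The same reasoning shows that the `𝔤`-invariants of `D` are the scalars, so an invariant functional
is determined by its value at `1`. Hence `T` is fixed by `β` and by the Galois group, both preserve
the pieces, and `β = i^n` on `piece n`. Now `T(abc)` vanishes unless the three degrees satisfy the
triangle inequalities (orthogonality and the supertrace property) and have even doubled sum (`β²`);
this gives the range of degrees. Applying `β` to `ab` reverses the factors at the cost of a power of
`i`, which gives the parity `(-1)^p` and shows that the second term of the product is half the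
commutator, that is, half the Poisson bracket. -/

/-! ### Semisimple Lie algebras: Casimir operators and complete reducibility. -/

section LieTheory

open Module

variable {K L M : Type*} [Field K] [LieRing L] [LieAlgebra K L] [FiniteDimensional K L]
  [LieAlgebra.IsKilling K L] [AddCommGroup M] [Module K M] [LieRingModule L M] [LieModule K L M]
  [FiniteDimensional K M]

-- By invariance of the Killing form, the orthogonal of `[L, L]` is central, hence zero.
variable (K L) in
theorem LieAlgebra.IsKilling.lie_top_eq_top : ⁅(⊤ : LieIdeal K L), (⊤ : LieIdeal K L)⁆ = ⊤ := by
  set N : LieIdeal K L := ⁅(⊤ : LieIdeal K L), (⊤ : LieIdeal K L)⁆ with hN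
  have h := LieIdeal.isCompl_killingCompl (K := K) (L := L) N
  have h0 : LieIdeal.killingCompl K L N = ⊥ := by
    rw [eq_bot_iff, ← LieAlgebra.center_eq_bot K L]
    intro x hx
    rw [LieModule.mem_maxTrivSubmodule]
    intro y
    refine (LieAlgebra.IsKilling.killingForm_nondegenerate K L).1 _ fun z => ?_
    rw [← lie_skew, map_neg, LinearMap.neg_apply, LieModule.traceForm_apply_lie_apply,
      LieModule.traceForm_comm, (LieIdeal.mem_killingCompl K L N).mp hx _
        (LieSubmodule.lie_mem_lie (LieSubmodule.mem_top y) (LieSubmodule.mem_top z)), neg_zero]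
  rw [h0] at h
  exact eq_top_of_isCompl_bot h

/-- A vanishing trace form makes the derived algebra act nilpotently, and a Killing Lie algebra is
its own derived algebra. Perfectness also makes the lower central series of `M` constant from its
first step on, so nilpotency forces that step to be zero. -/
theorem LieModule.lie_eq_zero_of_traceForm_eq_zero [CharZero K]
    (h : LieModule.traceForm K L M = 0) (x : L) (m : M) : ⁅x, m⁆ = 0 := by
  have hp := LieAlgebra.IsKilling.lie_top_eq_top K L
  have hd : LieAlgebra.derivedSeries K L 1 = ⊤ := by
    simpa [LieAlgebra.derivedSeries_def] using hp
  have hn := LieModule.isNilpotent_derivedSeries_of_traceForm_eq_zero h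
  have hn' : LieModule.IsNilpotent L M := by
    rw [LieModule.isNilpotent_iff_forall' (R := K)] at hn ⊢
    intro x
    exact hn ⟨x, hd ▸ LieSubmodule.mem_top x⟩
  -- It suffices to treat brackets `[y, z]`, which span `L`; these act as `yz - zy`.
  have hstep : ∀ N : LieSubmodule K L M,
      ⁅(⊤ : LieIdeal K L), ⁅(⊤ : LieIdeal K L), N⁆⁆ = ⁅(⊤ : LieIdeal K L), N⁆ := by
    intro N
    refine le_antisymm (LieSubmodule.lie_le_right _ _) ?_
    conv_lhs => rw [← hp]
    refine (LieSubmodule.lieIdeal_oper_eq_span _ _).le.trans ?_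
    rw [LieSubmodule.lieSpan_le]
    rintro _ ⟨⟨x, hx⟩, n, rfl⟩
    have hx' : x ∈ Submodule.span K {z : L | ∃ a ∈ (⊤ : LieIdeal K L), ∃ b ∈ (⊤ : LieIdeal K L),
        ⁅a, b⁆ = z} := by
      rw [← LieSubmodule.lieIdeal_oper_eq_linear_span']
      exact hx
    change ⁅x, (n : M)⁆ ∈ ⁅(⊤ : LieIdeal K L), ⁅(⊤ : LieIdeal K L), N⁆⁆
    clear hx
    induction hx' using Submodule.span_induction with
    | mem x hx =>
      obtain ⟨y, -, z, -, rfl⟩ := hx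
      change ⁅⁅y, z⁆, (n : M)⁆ ∈ _
      rw [lie_lie]
      exact sub_mem
        (LieSubmodule.lie_mem_lie (LieSubmodule.mem_top _)
          (LieSubmodule.lie_mem_lie (LieSubmodule.mem_top _) n.2))
        (LieSubmodule.lie_mem_lie (LieSubmodule.mem_top _)
          (LieSubmodule.lie_mem_lie (LieSubmodule.mem_top _) n.2))
    | zero => change ⁅(0 : L), (n : M)⁆ ∈ _; simp
    | add a b ha hb h1 h2 =>
      change ⁅a + b, (n : M)⁆ ∈ _
      rw [add_lie]
      exact add_mem h1 h2
    | smul c a ha h1 =>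
      change ⁅c • a, (n : M)⁆ ∈ _
      rw [smul_lie]
      exact SMulMemClass.smul_mem _ h1
  have hl : ∀ k, LieModule.lowerCentralSeries K L M (k + 1) =
      LieModule.lowerCentralSeries K L M 1 := by
    intro k
    induction k with
    | zero => rfl
    | succ k ih =>
      rw [LieModule.lowerCentralSeries_succ, ih, LieModule.lowerCentralSeries_succ]
      exact hstep _
  obtain ⟨k, hk⟩ := (LieModule.isNilpotent_iff K L M).mp hn'
  have h1 : LieModule.lowerCentralSeries K L M 1 = ⊥ := by
    rw [← hl k, LieModule.lowerCentralSeries_succ, hk]; simp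
  have : ⁅x, m⁆ ∈ LieModule.lowerCentralSeries K L M 1 := by
    rw [LieModule.lowerCentralSeries_succ]
    exact LieSubmodule.lie_mem_lie (LieSubmodule.mem_top _) (by simp)
  rw [h1] at this
  simpa using this

/-- A Casimir operator: an endomorphism with values in `L · M`, commuting with `L` and of nonzero
trace. -/
theorem LieModule.exists_casimir [CharZero K] (h : LieModule.traceForm K L M ≠ 0) :
    ∃ C : End K M, (∀ x, Commute C (LieModule.toEnd K L M x)) ∧
      (∀ m, C m ∈ Submodule.span K {n : M | ∃ (x : L) (m : M), n = ⁅x, m⁆}) ∧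
      LinearMap.trace K M C ≠ 0 := by
  set τ := LieModule.traceForm K L M with hτ
  have hinv : ∀ x y z : L, τ ⁅x, y⁆ z = - τ y ⁅x, z⁆ := fun x y z => by
    rw [← lie_skew, map_neg, LinearMap.neg_apply, LieModule.traceForm_apply_lie_apply]
  -- The radical of the trace form is an ideal; its Killing complement `J` is an ideal on which the
  -- trace form is nondegenerate. The Casimir operator is built from dual bases of `J`.
  let I : LieIdeal K L :=
    { LinearMap.ker τ with
      lie_mem := by
        intro x y hy
        have hy' : τ y = 0 := hy
        change τ ⁅x, y⁆ = 0
        ext z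
        rw [hinv, hy']; simp }
  have hI : ∀ x, x ∈ I ↔ τ x = 0 := fun x => Iff.rfl
  set J := LieIdeal.killingCompl K L I with hJ
  have hc : IsCompl I J := LieIdeal.isCompl_killingCompl I
  let J' : Submodule K L := J.toSubmodule
  let B : LinearMap.BilinForm K J' := τ.restrict J'
  have hBs : B.IsSymm := ⟨fun x y => LieModule.traceForm_comm K L M x y⟩
  have hsep : ∀ x : J', (∀ y, B x y = 0) → x = 0 := by
    intro x hx
    have hxI : (x : L) ∈ I := by
      rw [hI]
      ext z
      have hz : z ∈ I ⊔ J := hc.sup_eq_top ▸ LieSubmodule.mem_top z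
      obtain ⟨a, ha, b, hb, rfl⟩ := (LieSubmodule.mem_sup _ _ _).mp hz
      have h1 : τ x a = 0 := by
        rw [hτ, LieModule.traceForm_comm, ← hτ, (hI a).mp ha]; rfl
      have h2 : τ x b = 0 := hx ⟨b, hb⟩
      simp [h1, h2]
    have : (x : L) ∈ I ⊓ J := ⟨hxI, x.2⟩
    rw [hc.inf_eq_bot] at this
    exact Subtype.ext (by simpa using this)
  have hB : B.Nondegenerate := (hBs.isRefl.nondegenerate_iff_separatingLeft).mpr hsep
  let b := finBasis K J'
  let b' := B.dualBasis hB b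
  let ρ := LieModule.toEnd K L M
  have hexp : ∀ x : J', x = ∑ j, B x (b' j) • b j := by
    intro x
    conv_lhs => rw [← b.sum_repr x]
    refine Finset.sum_congr rfl fun j _ => ?_
    congr 1
    have : B (∑ i, b.repr x i • b i) (b' j) = b.repr x j := by
      simp only [map_sum, LinearMap.sum_apply, map_smul, LinearMap.smul_apply, b',
        LinearMap.BilinForm.apply_dualBasis_right hB hBs]
      simp
    rw [b.sum_repr] at this
    exact this.symm
  have hexp' : ∀ x : J', x = ∑ j, B x (b j) • b' j := by
    intro x
    conv_lhs => rw [← b'.sum_repr x]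
    refine Finset.sum_congr rfl fun j _ => ?_
    rw [LinearMap.BilinForm.dualBasis_repr_apply]
  refine ⟨∑ i, ρ (b i) * ρ (b' i), ?_, ?_, ?_⟩
  · intro x
    have hadj : ∀ y : J', ∃ z : J', (z : L) = ⁅x, (y : L)⁆ := fun y =>
      ⟨⟨⁅x, (y : L)⁆, J.lie_mem y.2⟩, rfl⟩
    choose a ha using hadj
    have e1 : ∀ y : J', ρ ⁅x, (y : L)⁆ = ∑ j, B (a y) (b' j) • ρ (b j) := by
      intro y
      rw [← ha]
      conv_lhs => rw [hexp (a y)]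
      simp
    have e2 : ∀ y : J', ρ ⁅x, (y : L)⁆ = ∑ j, B (a y) (b j) • ρ (b' j) := by
      intro y
      rw [← ha]
      conv_lhs => rw [hexp' (a y)]
      simp
    have e3 : ∀ y z : J', B (a y) z = - B (a z) y := by
      intro y z
      change τ (a y) z = - τ (a z) y
      rw [ha, ha, hinv, hτ, LieModule.traceForm_comm]
    -- By invariance, `ad x` has opposite transposed matrices in the two dual bases, so the double
    -- sums cancel.
    have key : ∑ i, (ρ ⁅x, (b i : L)⁆ * ρ (b' i) + ρ (b i) * ρ ⁅x, (b' i : L)⁆) = 0 := by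
      simp only [Finset.sum_add_distrib]
      simp only [e1 (b _), e2 (b' _), Finset.sum_mul, Finset.mul_sum]
      rw [Finset.sum_comm (s := Finset.univ) (t := Finset.univ)
        (f := fun i j => ρ (b i) * B (a (b' i)) (b j) • ρ (b' j)), ← Finset.sum_add_distrib]
      refine Finset.sum_eq_zero fun i _ => ?_
      rw [← Finset.sum_add_distrib]
      refine Finset.sum_eq_zero fun j _ => ?_
      rw [e3 (b' j) (b i)]
      simp
    have hcomm : ∀ y, ρ ⁅x, y⁆ = ρ x * ρ y - ρ y * ρ x := by
      intro y; ext m; simp [ρ]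
    have h2 : ρ x * (∑ i, ρ (b i) * ρ (b' i)) - (∑ i, ρ (b i) * ρ (b' i)) * ρ x = 0 := by
      rw [← key, Finset.mul_sum, Finset.sum_mul, ← Finset.sum_sub_distrib]
      refine Finset.sum_congr rfl fun i _ => ?_
      rw [hcomm, hcomm]
      noncomm_ring
    exact (sub_eq_zero.mp h2).symm
  · intro m
    rw [LinearMap.sum_apply]
    refine Submodule.sum_mem _ fun i _ => Submodule.subset_span ⟨b i, ρ (b' i) m, rfl⟩
  -- Each summand has trace `τ(b i, b' i) = 1`, so the total trace is `dim J`, and `J = 0` would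
  -- mean that the trace form vanishes.
  · have ht : ∀ i, LinearMap.trace K M (ρ (b i) * ρ (b' i)) = 1 := by
      intro i
      have : B (b i) (b' i) = 1 := by
        rw [LinearMap.BilinForm.apply_dualBasis_right hB hBs]; simp
      exact this
    rw [map_sum]
    simp only [ht]
    simp only [Finset.sum_const, Finset.card_univ, Fintype.card_fin, nsmul_eq_mul, mul_one, ne_eq,
      Nat.cast_eq_zero]
    intro h0
    apply h
    have hJ0 : J' = ⊥ := Submodule.finrank_eq_zero.mp h0
    have hJ1 : J = ⊥ := by simpa [J'] using hJ0
    rw [hJ1] at hc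
    have hIt := eq_top_of_isCompl_bot hc
    ext x y
    have : τ x = 0 := (hI x).mp (hIt ▸ LieSubmodule.mem_top x)
    rw [this]; rfl

/-- Complete reducibility: a nonzero invariant functional on a finite-dimensional module of a
semisimple Lie algebra is nonzero on some invariant. -/
theorem LieModule.exists_invariant_apply_ne_zero [CharZero K] (l : Dual K M)
    (hl : ∀ (x : L) (m : M), l ⁅x, m⁆ = 0) (hne : l ≠ 0) :
    ∃ v : M, (∀ x : L, ⁅x, v⁆ = 0) ∧ l v ≠ 0 := by
  induction hn : finrank K M using Nat.strong_induction_on generalizing M with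
  | _ n ih =>
    by_cases hτ : LieModule.traceForm K L M = 0
    · obtain ⟨v, hv⟩ : ∃ v, l v ≠ 0 := by
        by_contra! h
        exact hne (LinearMap.ext h)
      exact ⟨v, fun x => LieModule.lie_eq_zero_of_traceForm_eq_zero hτ x v, hv⟩
    obtain ⟨C, hC1, hC2, hC3⟩ := LieModule.exists_casimir hτ
    -- Fitting decomposition of the Casimir operator. The exponent `k + 1` is positive, so the range
    -- part lies in `L · M`, where `l` vanishes. The kernel part is a submodule, and it is proper
    -- because a nilpotent `C` would have trace zero.
    obtain ⟨k, hk⟩ := Filter.eventually_atTop.mp (LinearMap.eventually_isCompl_ker_pow_range_pow C)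
    have hcompl := hk (k + 1) (by omega)
    have hlspan : ∀ m ∈ Submodule.span K {n : M | ∃ (x : L) (m : M), n = ⁅x, m⁆}, l m = 0 := by
      intro m hm
      induction hm using Submodule.span_induction with
      | mem x hx => obtain ⟨x, m, rfl⟩ := hx; exact hl x m
      | zero => simp
      | add a b _ _ h1 h2 => simp [h1, h2]
      | smul c a _ h1 => simp [h1]
    let N : LieSubmodule K L M :=
      { LinearMap.ker (C ^ (k + 1)) with
        lie_mem := by
          intro x m hm
          have hm' : (C ^ (k + 1)) m = 0 := hm
          change (C ^ (k + 1)) ⁅x, m⁆ = 0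
          have h1 := ((hC1 x).pow_left (k + 1)).eq
          have h2 := LinearMap.congr_fun h1 m
          simp only [Module.End.mul_apply, LieModule.toEnd_apply_apply] at h2
          rw [h2, hm', lie_zero] }
    have hlt : finrank K N < n := by
      rw [← hn]
      refine Submodule.finrank_lt (s := LinearMap.ker (C ^ (k + 1))) fun htop => hC3 ?_
      have : _root_.IsNilpotent C := ⟨k + 1, LinearMap.ker_eq_top.mp htop⟩
      exact (LinearMap.isNilpotent_trace_of_isNilpotent this).eq_zero
    have hlN : l ∘ₗ N.toSubmodule.subtype ≠ 0 := by
      intro h0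
      apply hne
      ext m
      have hm : m ∈ LinearMap.ker (C ^ (k + 1)) ⊔ LinearMap.range (C ^ (k + 1)) := by
        rw [hcompl.sup_eq_top]; trivial
      obtain ⟨a, ha, _, ⟨b, rfl⟩, rfl⟩ := Submodule.mem_sup.mp hm
      have h1 : l a = 0 := LinearMap.congr_fun h0 ⟨a, ha⟩
      have h2 : l ((C ^ (k + 1)) b) = 0 := by
        rw [pow_succ', Module.End.mul_apply]
        exact hlspan _ (hC2 _)
      rw [map_add, h1, h2]; simp
    obtain ⟨v, hv1, hv2⟩ := ih _ hlt (M := N) (l ∘ₗ N.toSubmodule.subtype)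
      (fun x m => hl x m) hlN rfl
    exact ⟨v, fun x => by simpa using congrArg Subtype.val (hv1 x), hv2⟩

end LieTheory

/-! ### Locally finite representations and the counting of intertwiners. -/

section Representations

open Module

variable {K L : Type*} [Field K] [LieRing L] [LieAlgebra K L]
  {U V A : Type*} [AddCommGroup U] [Module K U] [AddCommGroup V] [Module K V]
  [AddCommGroup A] [Module K A]

/-- The linear map `ρ` is a representation of the Lie algebra `L`. -/
def IsLieRep (ρ : L →ₗ[K] End K V) : Prop := ∀ x y, ρ ⁅x, y⁆ = ρ x * ρ y - ρ y * ρ x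

/-- Every vector lies in a finite-dimensional invariant subspace. -/
def IsLocallyFinite (ρ : L →ₗ[K] End K V) : Prop :=
  ∀ v, ∃ N : Submodule K V, N.FG ∧ v ∈ N ∧ ∀ x, ∀ w ∈ N, ρ x w ∈ N

/-- The space of intertwining maps. -/
def intertwiners (ρ : L →ₗ[K] End K U) (π : L →ₗ[K] End K V) : Submodule K (U →ₗ[K] V) where
  carrier := {f | ∀ x u, f (ρ x u) = π x (f u)}
  zero_mem' := by simp
  add_mem' {f g} hf hg x u := by simp [hf x u, hg x u]
  smul_mem' c f hf x u := by simp [hf x u]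

instance (ρ : L →ₗ[K] End K U) (π : L →ₗ[K] End K V) : AddCommGroup (intertwiners ρ π) :=
  Submodule.addCommGroup _

/-- The contragredient representation. -/
def dualRep (ρ : L →ₗ[K] End K V) : L →ₗ[K] End K (Dual K V) where
  toFun x := -(ρ x).dualMap
  map_add' x y := by ext; simp; abel
  map_smul' c x := by ext; simp

theorem dualRep_apply (ρ : L →ₗ[K] End K V) (x : L) (ξ : Dual K V) (v : V) :
    dualRep ρ x ξ v = - ξ (ρ x v) := rfl

theorem IsLieRep.dual {ρ : L →ₗ[K] End K V} (h : IsLieRep ρ) : IsLieRep (dualRep ρ) := by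
  intro x y
  ext ξ v
  simp [dualRep_apply, h x y]

/-- The restriction of a representation to an invariant subspace. -/
def restrictRep (ρ : L →ₗ[K] End K V) (N : Submodule K V) (hN : ∀ x, ∀ v ∈ N, ρ x v ∈ N) :
    L →ₗ[K] End K N where
  toFun x := (ρ x).restrict (hN x)
  map_add' x y := by ext; simp
  map_smul' c x := by ext; simp

theorem restrictRep_apply (ρ : L →ₗ[K] End K V) (N : Submodule K V)
    (hN : ∀ x, ∀ v ∈ N, ρ x v ∈ N) (x : L) (v : N) :
    (restrictRep ρ N hN x v : V) = ρ x v := rfl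

theorem IsLieRep.restrict {ρ : L →ₗ[K] End K V} (h : IsLieRep ρ) (N : Submodule K V)
    (hN : ∀ x, ∀ v ∈ N, ρ x v ∈ N) : IsLieRep (restrictRep ρ N hN) := by
  intro x y
  ext v
  simp [restrictRep_apply, h x y]

/-- The representation on linear maps. -/
def homRep (ρ : L →ₗ[K] End K U) (π : L →ₗ[K] End K V) : L →ₗ[K] End K (U →ₗ[K] V) where
  toFun x :=
    { toFun := fun f => π x ∘ₗ f - f ∘ₗ ρ x
      map_add' := fun f g => by ext; simp; abel
      map_smul' := fun c f => by ext; simp [smul_sub] }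
  map_add' x y := by ext; simp; abel
  map_smul' c x := by ext; simp [smul_sub]

theorem homRep_apply (ρ : L →ₗ[K] End K U) (π : L →ₗ[K] End K V) (x : L) (f : U →ₗ[K] V) :
    homRep ρ π x f = π x ∘ₗ f - f ∘ₗ ρ x := rfl

theorem IsLieRep.hom {ρ : L →ₗ[K] End K U} {π : L →ₗ[K] End K V} (hρ : IsLieRep ρ)
    (hπ : IsLieRep π) : IsLieRep (homRep ρ π) := by
  intro x y
  ext f u
  simp [homRep_apply, hρ x y, hπ x y]
  abel

variable [CharZero K] [FiniteDimensional K L] [LieAlgebra.IsKilling K L]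

theorem IsLieRep.exists_invariant [FiniteDimensional K V] {ρ : L →ₗ[K] End K V} (h : IsLieRep ρ)
    (l : Dual K V) (hl : ∀ x v, l (ρ x v) = 0) (hne : l ≠ 0) :
    ∃ v, (∀ x, ρ x v = 0) ∧ l v ≠ 0 := by
  let _ : LieRingModule L V :=
    { bracket := fun x v => ρ x v
      add_lie := fun x y v => by simp
      lie_add := fun x v w => by simp
      leibniz_lie := fun x y v => by
        change ρ x (ρ y v) = ρ ⁅x, y⁆ v + ρ y (ρ x v)
        rw [h]; simp }
  have _ : LieModule K L V :=
    { smul_lie := fun c x v => by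
        change ρ (c • x) v = c • ρ x v
        simp
      lie_smul := fun c x v => by
        change ρ x (c • v) = c • ρ x v
        simp }
  exact LieModule.exists_invariant_apply_ne_zero (L := L) l hl hne

theorem IsLieRep.exists_invariant_of_isLocallyFinite {ρ : L →ₗ[K] End K A} (h : IsLieRep ρ)
    (hf : IsLocallyFinite ρ) (l : Dual K A) (hl : ∀ x v, l (ρ x v) = 0) (hne : l ≠ 0) :
    ∃ v, (∀ x, ρ x v = 0) ∧ l v ≠ 0 := by
  obtain ⟨a, ha⟩ : ∃ a, l a ≠ 0 := by
    by_contra! h0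
    exact hne (LinearMap.ext h0)
  obtain ⟨N, hN, haN, hNx⟩ := hf a
  have : FiniteDimensional K N := Module.Finite.iff_fg.mpr hN
  obtain ⟨v, hv, hv'⟩ := (h.restrict N hNx).exists_invariant (l ∘ₗ N.subtype)
    (fun x v => hl x v) (fun h0 => ha (LinearMap.congr_fun h0 ⟨a, haN⟩))
  exact ⟨v, fun x => congrArg Subtype.val (hv x), hv'⟩

/-- The functional `g ↦ tr(α g)` on `Hom(U, N)`, with `N` a finite-dimensional invariant subspace on
which `α ≠ 0`, is invariant and is nonzero on some map of rank one. By complete reducibility it is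
nonzero on an invariant, which is an intertwiner. -/
theorem exists_intertwiner_trace_ne_zero [FiniteDimensional K U] {ρ : L →ₗ[K] End K U}
    {π : L →ₗ[K] End K A} (hρ : IsLieRep ρ) (hπ : IsLieRep π) (hf : IsLocallyFinite π)
    (α : A →ₗ[K] U) (hα : α ∈ intertwiners π ρ) (hne : α ≠ 0) :
    ∃ g ∈ intertwiners ρ π, LinearMap.trace K U (α ∘ₗ g) ≠ 0 := by
  obtain ⟨a, ha⟩ : ∃ a, α a ≠ 0 := by
    by_contra! h0
    exact hne (LinearMap.ext h0)
  obtain ⟨N, hN, haN, hNx⟩ := hf a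
  have : FiniteDimensional K N := Module.Finite.iff_fg.mpr hN
  let αN : N →ₗ[K] U := α ∘ₗ N.subtype
  let l : Dual K (U →ₗ[K] N) :=
    { toFun := fun g => LinearMap.trace K U (αN ∘ₗ g)
      map_add' := fun f g => by rw [LinearMap.comp_add, map_add]
      map_smul' := fun c f => by rw [LinearMap.comp_smul, map_smul]; rfl }
  have hl : ∀ x g, l (homRep ρ (restrictRep π N hNx) x g) = 0 := by
    intro x g
    change LinearMap.trace K U (αN ∘ₗ (restrictRep π N hNx x ∘ₗ g - g ∘ₗ ρ x)) = 0
    have h1 : αN ∘ₗ (restrictRep π N hNx x ∘ₗ g) = ρ x * (αN ∘ₗ g) := by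
      ext u
      exact hα x (g u)
    have h2 : αN ∘ₗ (g ∘ₗ ρ x) = (αN ∘ₗ g) * ρ x := rfl
    rw [LinearMap.comp_sub, map_sub, h1, h2, LinearMap.trace_mul_comm, sub_self]
  have hl0 : l ≠ 0 := by
    intro h0
    obtain ⟨ξ, hξ⟩ : ∃ ξ : Dual K U, ξ (α a) ≠ 0 := by
      by_contra! h
      exact ha ((forall_dual_apply_eq_zero_iff K _).mp h)
    have h1 : LinearMap.trace K U (αN ∘ₗ ξ.smulRight ⟨a, haN⟩) = 0 := LinearMap.congr_fun h0 _
    have h2 : αN ∘ₗ ξ.smulRight ⟨a, haN⟩ = ξ.smulRight (α a) := by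
      ext u
      simp [αN]
    rw [h2, LinearMap.trace_smulRight] at h1
    exact hξ h1
  obtain ⟨g, hg, hg'⟩ := (hρ.hom (hπ.restrict N hNx)).exists_invariant l hl hl0
  refine ⟨N.subtype ∘ₗ g, fun x u => ?_, hg'⟩
  have := congrArg Subtype.val (LinearMap.congr_fun (hg x) u)
  rw [homRep_apply] at this
  simp only [LinearMap.sub_apply, LinearMap.comp_apply, LinearMap.zero_apply, Submodule.coe_sub,
    Submodule.coe_zero, restrictRep_apply, sub_eq_zero] at this
  exact this.symm

/-- The trace pairing between intertwiners `A → U` and `U → A`. -/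
noncomputable def tracePairing (ρ : L →ₗ[K] End K U) (π : L →ₗ[K] End K A) :
    intertwiners π ρ →ₗ[K] Dual K (intertwiners ρ π) :=
  LinearMap.mk₂ K (fun α g => LinearMap.trace K U ((α : A →ₗ[K] U) ∘ₗ (g : U →ₗ[K] A)))
    (fun a b c => by simp [LinearMap.add_comp]) (fun a b c => by simp [LinearMap.smul_comp])
    (fun a b c => by simp [LinearMap.comp_add]) (fun a b c => by simp [LinearMap.comp_smul])

/-- For finite multiplicities this yields `dim Hom(A, U) ≤ dim Hom(U, A)`. -/
theorem tracePairing_injective [FiniteDimensional K U] {ρ : L →ₗ[K] End K U}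
    {π : L →ₗ[K] End K A} (hρ : IsLieRep ρ) (hπ : IsLieRep π) (hf : IsLocallyFinite π) :
    Function.Injective (tracePairing ρ π) := by
  refine (injective_iff_map_eq_zero _).mpr fun α h => ?_
  by_contra hne
  obtain ⟨g, hg, h1⟩ := exists_intertwiner_trace_ne_zero hρ hπ hf α.1 α.2
    (fun h0 => hne (Subtype.ext h0))
  exact h1 (LinearMap.congr_fun h ⟨g, hg⟩)

/-- Over a semisimple Lie algebra, an invariant pairing of a finite-dimensional representation `V`
with a locally finite representation `A` that has a nondegenerate invariant form, and finite
multiplicities of `V` and of its contragredient `V'`, is given by an intertwiner `V → A`. -/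
theorem exists_intertwiner_eq_pairing [FiniteDimensional K V] [FiniteDimensional K U]
    {ρ : L →ₗ[K] End K V} {ρ' : L →ₗ[K] End K U}
    {π : L →ₗ[K] End K A} (hρ : IsLieRep ρ) (hρ' : IsLieRep ρ') (hπ : IsLieRep π)
    (hf : IsLocallyFinite π) (e : U ≃ₗ[K] Dual K V)
    (he : ∀ x u v, e (ρ' x u) v = - e u (ρ x v))
    [FiniteDimensional K (intertwiners ρ π)] [FiniteDimensional K (intertwiners ρ' π)]
    (P : A →ₗ[K] A →ₗ[K] K) (hP : ∀ x a b, P (π x a) b = - P a (π x b))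
    (hPl : ∀ a, (∀ b, P a b = 0) → a = 0)
    (Q : V →ₗ[K] A →ₗ[K] K) (hQ : ∀ x v a, Q (ρ x v) a = - Q v (π x a)) :
    ∃ f ∈ intertwiners ρ π, ∀ v a, Q v a = P (f v) a := by
  have i1 := tracePairing_injective hρ hπ hf
  have i2 := tracePairing_injective hρ' hπ hf
  have fd1 : FiniteDimensional K (intertwiners π ρ) := FiniteDimensional.of_injective _ i1
  have fd2 : FiniteDimensional K (intertwiners π ρ') := FiniteDimensional.of_injective _ i2
  have le1 := (LinearMap.finrank_le_finrank_of_injective i1).trans_eq Subspace.dual_finrank_eq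
  have le2 := (LinearMap.finrank_le_finrank_of_injective i2).trans_eq Subspace.dual_finrank_eq
  -- Contracting with the form `P` embeds `Hom(V, A)` into `Hom(A, V')`. The pairing `Q` is an
  -- element of the target, so surjectivity is what has to be shown.
  let Φ : intertwiners ρ π →ₗ[K] intertwiners π ρ' :=
    { toFun := fun f => ⟨e.symm.toLinearMap ∘ₗ (P ∘ₗ f.1).flip, fun x a => by
        apply e.injective
        ext v
        rw [he]
        simp only [LinearMap.comp_apply, LinearEquiv.coe_coe, LinearEquiv.apply_symm_apply,
          LinearMap.flip_apply]
        rw [f.2 x v, hP, neg_neg]⟩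
      map_add' := fun f g => by
        ext a
        have h : (P ∘ₗ (f + g).1).flip a = (P ∘ₗ f.1).flip a + (P ∘ₗ g.1).flip a := by ext; simp
        change e.symm _ = e.symm _ + e.symm _
        rw [h, map_add]
      map_smul' := fun c f => by
        ext a
        have h : (P ∘ₗ (c • f).1).flip a = c • (P ∘ₗ f.1).flip a := by ext; simp
        change e.symm _ = c • e.symm _
        rw [h, map_smul] }
  have hΦ : Function.Injective Φ := by
    refine (injective_iff_map_eq_zero _).mpr fun f h => ?_
    ext v
    refine hPl _ fun b => ?_
    have h1 : e.symm ((P ∘ₗ f.1).flip b) = 0 := LinearMap.congr_fun (congrArg Subtype.val h) b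
    rw [LinearEquiv.map_eq_zero_iff] at h1
    exact LinearMap.congr_fun h1 v
  let E := (evalEquiv K V).trans e.dualMap
  have hE : ∀ (u : U) z, e u (E.symm z) = z u := by
    intro u z
    have h1 : E (E.symm z) u = z u := by rw [E.apply_symm_apply]
    exact h1
  let Ψ : intertwiners ρ' π →ₗ[K] intertwiners π ρ :=
    { toFun := fun f => ⟨E.symm.toLinearMap ∘ₗ (P ∘ₗ f.1).flip, fun x a => by
        apply E.injective
        ext u
        change e u _ = e u _
        simp only [LinearMap.comp_apply, LinearEquiv.coe_coe]
        rw [hE, ← neg_neg (e u _), ← he, hE]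
        simp only [LinearMap.flip_apply, LinearMap.comp_apply]
        rw [f.2 x u, hP, neg_neg]⟩
      map_add' := fun f g => by
        ext a
        have h : (P ∘ₗ (f + g).1).flip a = (P ∘ₗ f.1).flip a + (P ∘ₗ g.1).flip a := by ext; simp
        change E.symm _ = E.symm _ + E.symm _
        rw [h, map_add]
      map_smul' := fun c f => by
        ext a
        have h : (P ∘ₗ (c • f).1).flip a = c • (P ∘ₗ f.1).flip a := by ext; simp
        change E.symm _ = c • E.symm _
        rw [h, map_smul] }
  have hΨ : Function.Injective Ψ := by
    refine (injective_iff_map_eq_zero _).mpr fun f h => ?_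
    ext u
    refine hPl _ fun b => ?_
    have h1 : E.symm ((P ∘ₗ f.1).flip b) = 0 := LinearMap.congr_fun (congrArg Subtype.val h) b
    rw [LinearEquiv.map_eq_zero_iff] at h1
    exact LinearMap.congr_fun h1 u
  have le3 := LinearMap.finrank_le_finrank_of_injective hΦ
  have le4 := LinearMap.finrank_le_finrank_of_injective hΨ
  -- The inequalities close up: `Hom(V, A) ≤ Hom(A, V') ≤ Hom(V', A) ≤ Hom(A, V) ≤ Hom(V, A)` in
  -- dimension.
  have heq : finrank K (intertwiners ρ π) = finrank K (intertwiners π ρ') := by omega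
  have hsurj := (LinearMap.injective_iff_surjective_of_finrank_eq_finrank heq).mp hΦ
  obtain ⟨f, hf'⟩ := hsurj ⟨e.symm.toLinearMap ∘ₗ Q.flip, fun x a => by
    apply e.injective
    ext v
    rw [he]
    simp only [LinearMap.comp_apply, LinearEquiv.coe_coe, LinearEquiv.apply_symm_apply,
      LinearMap.flip_apply]
    rw [hQ, neg_neg]⟩
  refine ⟨f.1, f.2, fun v a => ?_⟩
  have h1 : e.symm ((P ∘ₗ f.1).flip a) = e.symm (Q.flip a) :=
    LinearMap.congr_fun (congrArg Subtype.val hf') a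
  exact (LinearMap.congr_fun (e.symm.injective h1) v).symm

end Representations

/-! ### Holomorphic functions on a connected complex Lie group. -/

section HolomorphicFunctions

variable {d : ℕ} {G : Type*} [TopologicalSpace G] [ChartedSpace (EuclideanSpace ℂ (Fin d)) G]

/-- A holomorphic function with vanishing differential on a connected manifold is constant. -/
theorem apply_eq_of_hasMFDerivAt_zero [IsManifold 𝓘(ℂ, EuclideanSpace ℂ (Fin d)) 1 G]
    [PreconnectedSpace G] {f : G → ℂ}
    (hf : ∀ g, HasMFDerivAt 𝓘(ℂ, EuclideanSpace ℂ (Fin d)) 𝓘(ℂ, ℂ) f g 0) (a b : G) :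
    f a = f b := by
  refine IsLocallyConstant.apply_eq_of_preconnectedSpace ?_ a b
  rw [IsLocallyConstant.iff_eventually_eq]
  intro g
  set ψ := extChartAt 𝓘(ℂ, EuclideanSpace ℂ (Fin d)) g with hψ
  have hopen : IsOpen ψ.target := isOpen_extChartAt_target g
  have hd : ∀ p ∈ ψ.target, HasFDerivAt (f ∘ ψ.symm) (0 : EuclideanSpace ℂ (Fin d) →L[ℂ] ℂ) p := by
    intro p hp
    have h1 : MDifferentiableAt 𝓘(ℂ, EuclideanSpace ℂ (Fin d)) 𝓘(ℂ, EuclideanSpace ℂ (Fin d))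
        ψ.symm p :=
      ((contMDiffOn_extChartAt_symm (n := 1) g).contMDiffAt (hopen.mem_nhds hp)).mdifferentiableAt
        one_ne_zero
    have h2 := (hf (ψ.symm p)).comp p h1.hasMFDerivAt
    have h3 := h2.hasFDerivAt
    exact h3
  -- A ball in the chart is convex, so a function with zero derivative is constant on it.
  obtain ⟨r, hr, hball⟩ := Metric.isOpen_iff.mp hopen (ψ g) (mem_extChartAt_target g)
  have hmem : ψ ⁻¹' Metric.ball (ψ g) r ∈ nhds g :=
    (continuousAt_extChartAt g).preimage_mem_nhds (Metric.ball_mem_nhds _ hr)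
  filter_upwards [hmem, extChartAt_source_mem_nhds (I := 𝓘(ℂ, EuclideanSpace ℂ (Fin d))) g]
    with y hy hys
  have := Convex.is_const_of_fderivWithin_eq_zero (𝕜 := ℂ) (convex_ball (ψ g) r)
    (f := f ∘ ψ.symm)
    (fun p hp => (hd p (hball hp)).differentiableAt.differentiableWithinAt)
    (fun p hp => by
      rw [fderivWithin_of_isOpen Metric.isOpen_ball hp]
      exact (hd p (hball hp)).fderiv) hy (Metric.mem_ball_self hr)
  simp only [Function.comp_apply] at this
  rwa [ψ.left_inv hys, ψ.left_inv (mem_extChartAt_source g)] at this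

variable [Group G]

/-- The derivative of a function on the group at the identity. -/
noncomputable def dirDeriv (x : LieAlg d G) (f : G → ℂ) : ℂ :=
  mfderiv 𝓘(ℂ, EuclideanSpace ℂ (Fin d)) 𝓘(ℂ, ℂ) f 1 x

variable (d) in
/-- Holomorphic functions on the group. -/
abbrev Hol (f : G → ℂ) : Prop := MDifferentiable 𝓘(ℂ, EuclideanSpace ℂ (Fin d)) 𝓘(ℂ, ℂ) f

theorem dirDeriv_smul_left (c : ℂ) (x : LieAlg d G) (f : G → ℂ) :
    dirDeriv (c • x) f = c * dirDeriv x f :=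
  map_smul (mfderiv 𝓘(ℂ, EuclideanSpace ℂ (Fin d)) 𝓘(ℂ, ℂ) f 1) c x

theorem dirDeriv_add (x : LieAlg d G) {f g : G → ℂ} (hf : Hol d f) (hg : Hol d g) :
    dirDeriv x (f + g) = dirDeriv x f + dirDeriv x g :=
  DFunLike.congr_fun (mfderiv_add (hf 1) (hg 1)) x

theorem dirDeriv_mul (x : LieAlg d G) {f g : G → ℂ} (hf : Hol d f) (hg : Hol d g) :
    dirDeriv x (f * g) = f 1 * dirDeriv x g + g 1 * dirDeriv x f :=
  DFunLike.congr_fun ((hf 1).hasMFDerivAt.mul (hg 1).hasMFDerivAt).mfderiv x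

theorem dirDeriv_const (x : LieAlg d G) (c : ℂ) : dirDeriv x (fun _ : G => c) = 0 := by
  unfold dirDeriv
  rw [mfderiv_const]
  rfl

theorem dirDeriv_const_smul (x : LieAlg d G) (c : ℂ) {f : G → ℂ} (hf : Hol d f) :
    dirDeriv x (c • f) = c * dirDeriv x f :=
  DFunLike.congr_fun (const_smul_mfderiv (hf 1) c) x

theorem dirDeriv_sum {ι : Type} (s : Finset ι) (x : LieAlg d G) {f : ι → G → ℂ}
    (hf : ∀ i, Hol d (f i)) : dirDeriv x (∑ i ∈ s, f i) = ∑ i ∈ s, dirDeriv x (f i) := by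
  classical
  induction s using Finset.induction_on with
  | empty => exact dirDeriv_const x 0
  | insert i s hi ih =>
    rw [Finset.sum_insert hi, Finset.sum_insert hi, dirDeriv_add x (hf i), ih]
    exact MDifferentiable.sum fun i _ => hf i

variable [LieGroup 𝓘(ℂ, EuclideanSpace ℂ (Fin d)) ω G]

theorem Hol.comp_mul_right {f : G → ℂ} (hf : Hol d f) (g : G) : Hol d (fun k => f (k * g)) := by
  have h : ContMDiff 𝓘(ℂ, EuclideanSpace ℂ (Fin d)) 𝓘(ℂ, EuclideanSpace ℂ (Fin d)) ω
      (fun y : G => y * g) := contMDiff_mul_right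
  exact MDifferentiable.comp hf (h.mdifferentiable (by simp))

theorem Hol.comp_inv {f : G → ℂ} (hf : Hol d f) : Hol d (fun k => f k⁻¹) := by
  have h : ContMDiff 𝓘(ℂ, EuclideanSpace ℂ (Fin d)) 𝓘(ℂ, EuclideanSpace ℂ (Fin d)) ω
      (fun y : G => y⁻¹) := contMDiff_inv _ _
  exact MDifferentiable.comp hf (h.mdifferentiable (by simp))

/-- Right translation carries the derivative at `g` to the derivative at `1`, so it suffices to test
the translates of `f` at the identity. -/
theorem Hol.eq_of_dirDeriv_eq_zero [PreconnectedSpace G] {f : G → ℂ} (hf : Hol d f)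
    (h : ∀ (g : G) (x : LieAlg d G), dirDeriv x (fun k => f (k * g)) = 0) (a b : G) : f a = f b := by
  have : IsManifold 𝓘(ℂ, EuclideanSpace ℂ (Fin d)) 1 G :=
    IsManifold.of_le (n := ω) (by simp)
  refine apply_eq_of_hasMFDerivAt_zero (d := d) (fun g => ?_) a b
  have h1 : HasMFDerivAt 𝓘(ℂ, EuclideanSpace ℂ (Fin d)) 𝓘(ℂ, ℂ) (fun k => f (k * g)) 1
      (0 : EuclideanSpace ℂ (Fin d) →L[ℂ] ℂ) := by
    have h2 := (hf.comp_mul_right g 1).hasMFDerivAt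
    have h3 : mfderiv 𝓘(ℂ, EuclideanSpace ℂ (Fin d)) 𝓘(ℂ, ℂ) (fun k => f (k * g)) 1 =
      (0 : EuclideanSpace ℂ (Fin d) →L[ℂ] ℂ) := ContinuousLinearMap.ext fun x => h g x
    rwa [h3] at h2
  have hm : ContMDiff 𝓘(ℂ, EuclideanSpace ℂ (Fin d)) 𝓘(ℂ, EuclideanSpace ℂ (Fin d)) ω
      (fun y : G => y * g⁻¹) := contMDiff_mul_right
  have h4 := (hm.mdifferentiable (by simp) g).hasMFDerivAt
  have h5 : HasMFDerivAt 𝓘(ℂ, EuclideanSpace ℂ (Fin d)) 𝓘(ℂ, ℂ) (fun k => f (k * g)) (g * g⁻¹)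
      (0 : EuclideanSpace ℂ (Fin d) →L[ℂ] ℂ) := by
    rw [mul_inv_cancel]; exact h1
  have h6 := h5.comp g h4
  have h7 : (fun k => f (k * g)) ∘ (fun y : G => y * g⁻¹) = f := by ext; simp
  rw [h7] at h6
  convert! h6 using 1

end HolomorphicFunctions

/-! ### Holomorphic representations, their contragredients, and passage from `𝔤` to `G`. -/

section HolomorphicRepresentations

open Module

variable {d : ℕ} {G : Type*} [TopologicalSpace G] [ChartedSpace (EuclideanSpace ℂ (Fin d)) G]
  [Group G] [LieGroup 𝓘(ℂ, EuclideanSpace ℂ (Fin d)) ω G]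
  {V : Type*} [AddCommGroup V] [Module ℂ V]

/-- `π` is a holomorphic representation of `G` with differential `θ`. -/
structure IsHolRep (π : G →* End ℂ V) (θ : LieAlg d G →ₗ[ℂ] End ℂ V) : Prop where
  hol : ∀ (l : Dual ℂ V) (v : V), Hol d (fun g => l (π g v))
  deriv : ∀ (l : Dual ℂ V) (v : V) (x : LieAlg d G), dirDeriv x (fun g => l (π g v)) = l (θ x v)

theorem Module.Basis.apply_eq_sum_coord {ι R M N : Type*} [Fintype ι] [CommSemiring R]
    [AddCommMonoid M] [Module R M] [AddCommMonoid N] [Module R N] (b : Basis ι R M)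
    (T : M →ₗ[R] N) (v : M) : T v = ∑ i, b.coord i v • T (b i) := by
  conv_lhs => rw [← b.sum_repr v]
  simp [-Basis.sum_repr]

/-- The contragredient representation of a group. -/
def dualGroupRep (π : G →* End ℂ V) : G →* End ℂ (Dual ℂ V) where
  toFun g := (π g⁻¹).dualMap
  map_one' := by ext; simp
  map_mul' g h := by ext; simp

theorem dualGroupRep_apply (π : G →* End ℂ V) (g : G) (ξ : Dual ℂ V) (v : V) :
    dualGroupRep π g ξ v = ξ (π g⁻¹ v) := rfl

theorem IsHolRep.dirDeriv_inv [FiniteDimensional ℂ V] {π : G →* End ℂ V}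
    {θ : LieAlg d G →ₗ[ℂ] End ℂ V} (h : IsHolRep π θ) (l : Dual ℂ V) (v : V) (x : LieAlg d G) :
    dirDeriv x (fun g => l (π g⁻¹ v)) = - l (θ x v) := by
  let b := finBasis ℂ V
  -- The constant `l(π(g) π(g⁻¹) v)`, expanded in a basis, is a finite sum of products; the product
  -- rule then determines the derivative of `g ↦ l(π(g⁻¹) v)`.
  have h1 : (fun _ : G => l v) =
      ∑ i, (fun g => l (π g (b i))) * (fun g => b.coord i (π g⁻¹ v)) := by
    funext g
    simp only [Finset.sum_apply, Pi.mul_apply]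
    have e1 : v = π g (π g⁻¹ v) := by
      rw [← Module.End.mul_apply, ← map_mul]; simp
    conv_lhs => rw [e1]
    have := b.apply_eq_sum_coord (l ∘ₗ π g) (π g⁻¹ v)
    simpa only [LinearMap.comp_apply, smul_eq_mul, mul_comm] using this
  have hA : ∀ i, Hol d (fun g => l (π g (b i))) := fun i => h.hol l (b i)
  have hB : ∀ i, Hol d (fun g => b.coord i (π g⁻¹ v)) := fun i => (h.hol (b.coord i) v).comp_inv
  have h2 := congrArg (dirDeriv x) h1
  rw [dirDeriv_const, dirDeriv_sum _ _ (fun i => (hA i).mul (hB i))] at h2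
  simp only [dirDeriv_mul x (hA _) (hB _), h.deriv, Finset.sum_add_distrib] at h2
  have h3 : dirDeriv x (fun g => l (π g⁻¹ v)) =
      ∑ i, l (b i) * dirDeriv x (fun g => b.coord i (π g⁻¹ v)) := by
    have : (fun g => l (π g⁻¹ v)) = ∑ i, l (b i) • (fun g => b.coord i (π g⁻¹ v)) := by
      funext g
      simp only [Finset.sum_apply, Pi.smul_apply]
      have := b.apply_eq_sum_coord l (π g⁻¹ v)
      simpa only [smul_eq_mul, mul_comm] using this
    rw [this, dirDeriv_sum _ _ (fun i => MDifferentiable.const_smul _ (hB i))]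
    simp only [dirDeriv_const_smul x _ (hB _)]
  have h4 : l (θ x v) = ∑ i, b.coord i v * l (θ x (b i)) := by
    have := b.apply_eq_sum_coord (l ∘ₗ θ x) v
    simpa only [LinearMap.comp_apply, smul_eq_mul] using this
  rw [h3, h4]
  simp only [map_one, inv_one, Module.End.one_apply] at h2
  linear_combination -h2

theorem IsHolRep.dual [FiniteDimensional ℂ V] {π : G →* End ℂ V}
    {θ : LieAlg d G →ₗ[ℂ] End ℂ V} (h : IsHolRep π θ) :
    IsHolRep (dualGroupRep π) (dualRep θ) := by
  have key : ∀ (L : Dual ℂ (Dual ℂ V)) (ξ : Dual ℂ V), L ξ = ξ ((evalEquiv ℂ V).symm L) := by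
    intro L ξ
    rw [apply_evalEquiv_symm_apply]
  constructor
  · intro L ξ
    simp only [key L, dualGroupRep_apply]
    exact (h.hol ξ _).comp_inv
  · intro L ξ x
    simp only [key L, dualGroupRep_apply, dualRep_apply]
    exact h.dirDeriv_inv ξ _ x

namespace GaloisOrbitCover

variable (X : GaloisOrbitCover d G)

theorem vderiv_eq_dirDeriv (x : LieAlg d G) (f : X.M → ℂ) (m : X.M) :
    X.vderiv x f m = dirDeriv x (fun g : G => f (g • m)) := rfl

theorem hol_orbit (f : X.R) (m : X.M) : Hol d (fun g : G => (f : X.M → ℂ) (g • m)) :=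
  X.mdifferentiable_orbit f.2 m

/-- The derivative along a fundamental vector field at a point, as a functional. -/
noncomputable def vderivL (x : LieAlg d G) (m : X.M) : X.R →ₗ[ℂ] ℂ where
  toFun f := X.vderiv x f m
  map_add' a b := dirDeriv_add x (X.hol_orbit a m) (X.hol_orbit b m)
  map_smul' c a := dirDeriv_const_smul x c (X.hol_orbit a m)

theorem vderivL_apply (x : LieAlg d G) (m : X.M) (f : X.R) :
    X.vderivL x m f = X.vderiv x f m := rfl

theorem vderiv_mul (x : LieAlg d G) (a b : X.R) (m : X.M) :
    X.vderiv x ((a * b : X.R) : X.M → ℂ) m =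
      (a : X.M → ℂ) m * X.vderiv x b m + (b : X.M → ℂ) m * X.vderiv x a m := by
  have := dirDeriv_mul x (X.hol_orbit a m) (X.hol_orbit b m)
  simp only [one_smul] at this
  exact this

/-- Evaluation at a point, as a functional. -/
def evalL (m : X.M) : X.R →ₗ[ℂ] ℂ where
  toFun f := (f : X.M → ℂ) m
  map_add' _ _ := rfl
  map_smul' _ _ := rfl

/-- Infinitesimally equivariant maps from a holomorphic representation to `R` are equivariant. -/
theorem apply_smul_of_infinitesimally_equivariant [PreconnectedSpace G] [FiniteDimensional ℂ V]
    {π : G →* End ℂ V} {θ : LieAlg d G →ₗ[ℂ] End ℂ V} (h : IsHolRep π θ) (r : V →ₗ[ℂ] X.R)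
    (hr : ∀ x v m, (r (θ x v) : X.M → ℂ) m = - X.vderiv x (r v) m) (g : G) (v : V) (m : X.M) :
    (r (π g v) : X.M → ℂ) (g • m) = (r v : X.M → ℂ) m := by
  let b := finBasis ℂ V
  have hexp : ∀ (w : V) (m : X.M), (r w : X.M → ℂ) m = ∑ i, b.coord i w * (r (b i) : X.M → ℂ) m := by
    intro w m
    exact b.apply_eq_sum_coord (X.evalL m ∘ₗ r) w
  have hA : ∀ i (w : V), Hol d (fun g => b.coord i (π g w)) := fun i w => h.hol (b.coord i) w
  have hB : ∀ i (m : X.M), Hol d (fun g : G => (r (b i) : X.M → ℂ) (g • m)) :=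
    fun i m => X.hol_orbit (r (b i)) m
  have hF : ∀ (w : V) (m : X.M), (fun g : G => (r (π g w) : X.M → ℂ) (g • m)) =
      ∑ i, (fun g => b.coord i (π g w)) * (fun g : G => (r (b i) : X.M → ℂ) (g • m)) := by
    intro w m
    funext g
    rw [hexp]
    simp
  have hol : ∀ (w : V) (m : X.M), Hol d (fun g : G => (r (π g w) : X.M → ℂ) (g • m)) := by
    intro w m
    rw [hF]
    exact MDifferentiable.sum fun i _ => (hA i w).mul (hB i m)
  -- In the derivative of `r(π(g) w)(g m)` at `1`, moving the vector and moving the point contribute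
  -- opposite terms, by the hypothesis on `r`.
  have hd : ∀ (x : LieAlg d G) (w : V) (m : X.M),
      dirDeriv x (fun g : G => (r (π g w) : X.M → ℂ) (g • m)) = 0 := by
    intro x w m
    rw [hF, dirDeriv_sum _ _ (fun i => (hA i w).mul (hB i m))]
    simp only [dirDeriv_mul x (hA _ _) (hB _ _), h.deriv, Finset.sum_add_distrib]
    have e1 : ∑ i, (r (b i) : X.M → ℂ) ((1 : G) • m) * b.coord i (θ x w) =
        - X.vderiv x (r w) m := by
      rw [← hr, hexp]
      simp only [one_smul, mul_comm]
    have e2 : ∑ i, b.coord i (π 1 w) * dirDeriv x (fun g : G => (r (b i) : X.M → ℂ) (g • m)) =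
        X.vderiv x (r w) m := by
      rw [map_one]
      exact (b.apply_eq_sum_coord (X.vderivL x m ∘ₗ r) w).symm
    rw [e1, e2]; ring
  -- The derivative at `g₀` is the derivative at `1` for the vector `π(g₀) v` and the point `g₀ m`.
  have := (hol v m).eq_of_dirDeriv_eq_zero (fun g₀ x => by
    have h1 := hd x (π g₀ v) (g₀ • m)
    simp only [← Module.End.mul_apply, ← map_mul, smul_smul] at h1
    exact h1) g 1
  simpa using this

end GaloisOrbitCover

end HolomorphicRepresentations

/-! ### The differential of the adjoint representation is the Lie bracket. -/

section AdjointDerivative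

open Filter Topology

/-- The local form of the fact that the differential of the adjoint representation is the Lie
bracket: `m` is the multiplication of a local group with identity `p`, and `c` is conjugation. -/
theorem hasFDerivAt_conj_of_local_group {E : Type*} [NormedAddCommGroup E] [NormedSpace ℂ E]
    {m c : E × E → E} {p : E} (hm : ContDiffAt ℂ 2 m (p, p)) (hc : ContDiffAt ℂ 2 c (p, p))
    (hpm : ∀ᶠ b in 𝓝 p, m (p, b) = b) (hmp : ∀ᶠ a in 𝓝 p, m (a, p) = a)
    (hpc : ∀ᶠ b in 𝓝 p, c (p, b) = b) (hcp : ∀ᶠ a in 𝓝 p, c (a, p) = p)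
    (hmc : ∀ᶠ z in 𝓝 (p, p), m (c z, z.1) = m z) (y : E) :
    ∃ A' : E →L[ℂ] E, HasFDerivAt (fun a => fderiv ℂ (fun b => c (a, b)) p y) A' p ∧
      ∀ x, A' x = VectorField.lieBracket ℂ (fun a => fderiv ℂ (fun b => m (a, b)) p x)
        (fun a => fderiv ℂ (fun b => m (a, b)) p y) p := by
  have hpartial : ∀ f : E × E → E, ContDiffAt ℂ 2 f (p, p) → ∀ᶠ z in 𝓝 (p, p),
      DifferentiableAt ℂ f z := fun f hf => by
    have h1 := hf.eventually (by simp)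
    filter_upwards [h1] with z hz using hz.differentiableAt (by simp)
  have hin1 : Tendsto (fun a : E => (a, p)) (𝓝 p) (𝓝 (p, p)) :=
    (Continuous.prodMk_left p).tendsto p
  have hin2 : Tendsto (fun a : E => (p, a)) (𝓝 p) (𝓝 (p, p)) :=
    (Continuous.prodMk_right p).tendsto p
  have hd2 : ∀ (f : E × E → E) (a b : E), DifferentiableAt ℂ f (a, b) → ∀ v,
      fderiv ℂ (fun b => f (a, b)) b v = fderiv ℂ f (a, b) (0, v) := by
    intro f a b hf v
    have h1 : HasFDerivAt (fun b : E => (a, b)) (ContinuousLinearMap.inr ℂ E E) b :=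
      hasFDerivAt_prodMk_right a b
    have h2 : HasFDerivAt (fun b => f (a, b)) _ b := hf.hasFDerivAt.comp b h1
    rw [h2.fderiv]
    rfl
  have hd1 : ∀ (f : E × E → E) (a b : E), DifferentiableAt ℂ f (a, b) → ∀ v,
      fderiv ℂ (fun a => f (a, b)) a v = fderiv ℂ f (a, b) (v, 0) := by
    intro f a b hf v
    have h1 : HasFDerivAt (fun a : E => (a, b)) (ContinuousLinearMap.inl ℂ E E) a :=
      hasFDerivAt_prodMk_left a b
    have h2 : HasFDerivAt (fun a => f (a, b)) _ a := hf.hasFDerivAt.comp a h1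
    rw [h2.fderiv]
    rfl
  have hsnd : ∀ f : E × E → E, ContDiffAt ℂ 2 f (p, p) → HasFDerivAt (fderiv ℂ f)
      (fderiv ℂ (fderiv ℂ f) (p, p)) (p, p) := fun f hf =>
    ((hf.fderiv_right (m := 1) (by norm_num)).differentiableAt (by simp)).hasFDerivAt
  have hslice : ∀ f : E × E → E, ContDiffAt ℂ 2 f (p, p) → ∀ w,
      HasFDerivAt (fun a => fderiv ℂ (fun b => f (a, b)) p w)
        (((fderiv ℂ (fderiv ℂ f) (p, p)) ∘L (ContinuousLinearMap.inl ℂ E E)).flip (0, w)) p := by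
    intro f hf w
    have h1 : HasFDerivAt (fun a : E => (a, p)) (ContinuousLinearMap.inl ℂ E E) p :=
      hasFDerivAt_prodMk_left p p
    have h2 := (HasFDerivAt.comp (f := fun a : E => (a, p)) p (hsnd f hf) h1).clm_apply (hasFDerivAt_const ((0 : E), w) p)
    have h3 : (fun a => fderiv ℂ (fun b => f (a, b)) p w) =ᶠ[𝓝 p]
        fun a => fderiv ℂ f (a, p) (0, w) := by
      filter_upwards [hin1.eventually (hpartial f hf)] with a ha using hd2 f a p ha w
    refine (h2.congr_of_eventuallyEq h3).congr_fderiv ?_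
    ext v
    simp
  refine ⟨_, hslice c hc y, fun x => ?_⟩
  have hval : ∀ w, fderiv ℂ (fun b => m (p, b)) p w = w := by
    intro w
    have h1 : (fun b => m (p, b)) =ᶠ[𝓝 p] id := hpm
    rw [h1.fderiv_eq, fderiv_id]
    rfl
  have hval1 : ∀ w, fderiv ℂ m (p, p) (w, 0) = w := by
    intro w
    rw [← hd1 m p p (hpartial m hm).self_of_nhds]
    have h1 : (fun b => m (b, p)) =ᶠ[𝓝 p] id := hmp
    rw [h1.fderiv_eq, fderiv_id]
    rfl
  have hvalc : ∀ w, fderiv ℂ (fun b => c (p, b)) p w = w := by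
    intro w
    have h1 : (fun b => c (p, b)) =ᶠ[𝓝 p] id := hpc
    rw [h1.fderiv_eq, fderiv_id]
    rfl
  rw [VectorField.lieBracket_eq]
  simp only [hval]
  rw [(hslice m hm y).fderiv, (hslice m hm x).fderiv]
  simp only [ContinuousLinearMap.flip_apply, ContinuousLinearMap.comp_apply,
    ContinuousLinearMap.inl_apply]
  -- the identity `R_a ∘ conj_a = L_a`, differentiated at `p`
  have hcomm : ∀ᶠ a in 𝓝 p, fderiv ℂ m (p, a) (fderiv ℂ (fun b => c (a, b)) p y, 0) =
      fderiv ℂ (fun b => m (a, b)) p y := by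
    filter_upwards [hin1.eventually hmc.eventually_nhds, hin1.eventually (hpartial c hc),
      hin2.eventually (hpartial m hm), hcp] with a h1 h2 h3 h4
    have h5 : (fun b => m (c (a, b), a)) =ᶠ[𝓝 p] fun b => m (a, b) := by
      have : Tendsto (fun b : E => (a, b)) (𝓝 p) (𝓝 (a, p)) :=
        (Continuous.prodMk_right a).tendsto p
      exact this.eventually h1
    rw [← h5.fderiv_eq]
    have h6 : HasFDerivAt (fun b => c (a, b)) (fderiv ℂ (fun b => c (a, b)) p) p := by
      have : DifferentiableAt ℂ (fun b => c (a, b)) p :=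
        DifferentiableAt.comp p h2 (hasFDerivAt_prodMk_right a p).differentiableAt
      exact this.hasFDerivAt
    have h7 : HasFDerivAt (fun q => m (q, a)) ((fderiv ℂ m (p, a)) ∘L
        (ContinuousLinearMap.inl ℂ E E)) (c (a, p)) := by
      rw [h4]
      exact h3.hasFDerivAt.comp p (hasFDerivAt_prodMk_left p a)
    have h8 : HasFDerivAt (fun b => m (c (a, b), a)) _ p :=
      HasFDerivAt.comp (g := fun q => m (q, a)) (f := fun b => c (a, b)) p h7 h6
    rw [h8.fderiv]
    rfl
  have hl : HasFDerivAt (fun a => fderiv ℂ m (p, a) (fderiv ℂ (fun b => c (a, b)) p y, 0)) _ p :=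
    ((hsnd m hm).comp p (hasFDerivAt_prodMk_right p p)).clm_apply
      ((hslice c hc y).prodMk (hasFDerivAt_const (0 : E) p))
  have hu := hl.unique ((hslice m hm y).congr_of_eventuallyEq hcomm)
  -- The second differentiation gives `D²m((0,x),(y,0)) + A' x = D²m((x,0),(0,y))`. By symmetry of
  -- `D²m`, solving for `A' x` gives the bracket of the left-invariant fields of `x` and `y`.
  have hux := congrArg (fun T : E →L[ℂ] E => T x) hu
  simp [hvalc, hval1] at hux
  have hsymm : IsSymmSndFDerivAt ℂ m (p, p) := hm.isSymmSndFDerivAt (by simp)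
  rw [← hux, hsymm.eq (y, 0) (0, x)]
  abel

variable {d : ℕ} {G : Type*} [TopologicalSpace G] [ChartedSpace (EuclideanSpace ℂ (Fin d)) G]
  [Group G] [LieGroup 𝓘(ℂ, EuclideanSpace ℂ (Fin d)) ω G]

theorem mfderiv_at_one_eq_fderiv (f : G → G) (hf1 : f 1 = 1)
    (hf : MDifferentiableAt 𝓘(ℂ, EuclideanSpace ℂ (Fin d)) 𝓘(ℂ, EuclideanSpace ℂ (Fin d)) f 1)
    (y : LieAlg d G) :
    @Eq (EuclideanSpace ℂ (Fin d))
      (mfderiv 𝓘(ℂ, EuclideanSpace ℂ (Fin d)) 𝓘(ℂ, EuclideanSpace ℂ (Fin d)) f 1 y)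
    (fderiv ℂ (fun b => extChartAt 𝓘(ℂ, EuclideanSpace ℂ (Fin d)) (1 : G)
      (f ((extChartAt 𝓘(ℂ, EuclideanSpace ℂ (Fin d)) (1 : G)).symm b)))
      (extChartAt 𝓘(ℂ, EuclideanSpace ℂ (Fin d)) (1 : G) 1) y) := by
  refine (DFunLike.congr_fun hf.mfderiv y).trans ?_
  change fderivWithin ℂ (writtenInExtChartAt 𝓘(ℂ, EuclideanSpace ℂ (Fin d))
    𝓘(ℂ, EuclideanSpace ℂ (Fin d)) 1 f) (Set.range 𝓘(ℂ, EuclideanSpace ℂ (Fin d))) _ _ = _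
  simp only [writtenInExtChartAt, hf1, ModelWithCorners.range_eq_univ, fderivWithin_univ]
  rfl

/-- In the chart, the left-invariant field is the derivative of the local multiplication in its
second argument; this puts the bracket of `𝔤` in the form used by `hasFDerivAt_conj_of_local_group`.
-/
theorem mpullback_mulInvariantVectorField_chart (x : LieAlg d G) {a : EuclideanSpace ℂ (Fin d)}
    (ha : a ∈ (extChartAt 𝓘(ℂ, EuclideanSpace ℂ (Fin d)) (1 : G)).target) :
    @Eq (EuclideanSpace ℂ (Fin d))
      (VectorField.mpullbackWithin 𝓘(ℂ, EuclideanSpace ℂ (Fin d)) 𝓘(ℂ, EuclideanSpace ℂ (Fin d))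
        (extChartAt 𝓘(ℂ, EuclideanSpace ℂ (Fin d)) (1 : G)).symm (mulInvariantVectorField x)
        (Set.range 𝓘(ℂ, EuclideanSpace ℂ (Fin d))) a)
      (fderiv ℂ (fun b => extChartAt 𝓘(ℂ, EuclideanSpace ℂ (Fin d)) (1 : G)
        ((extChartAt 𝓘(ℂ, EuclideanSpace ℂ (Fin d)) (1 : G)).symm a *
          (extChartAt 𝓘(ℂ, EuclideanSpace ℂ (Fin d)) (1 : G)).symm b))
        (extChartAt 𝓘(ℂ, EuclideanSpace ℂ (Fin d)) (1 : G) 1) x) := by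
  have : IsManifold 𝓘(ℂ, EuclideanSpace ℂ (Fin d)) 1 G := IsManifold.of_le (n := ω) (by simp)
  set φ := extChartAt 𝓘(ℂ, EuclideanSpace ℂ (Fin d)) (1 : G) with hφ
  have hinv := ContinuousLinearMap.inverse_eq
    (mfderivWithin_extChartAt_symm_comp_mfderiv_extChartAt ha)
    (mfderiv_extChartAt_comp_mfderivWithin_extChartAt_symm ha)
  have hs : φ.symm a ∈ (chartAt (EuclideanSpace ℂ (Fin d)) (1 : G)).source := by
    rw [← extChartAt_source (I := 𝓘(ℂ, EuclideanSpace ℂ (Fin d)))]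
    exact φ.map_target ha
  refine (DFunLike.congr_fun hinv (mulInvariantVectorField x (φ.symm a))).trans ?_
  have hd : ∀ k, k = φ.symm a → HasMFDerivAt 𝓘(ℂ, EuclideanSpace ℂ (Fin d))
      𝓘(ℂ, EuclideanSpace ℂ (Fin d)) φ k
      (mfderiv 𝓘(ℂ, EuclideanSpace ℂ (Fin d)) 𝓘(ℂ, EuclideanSpace ℂ (Fin d)) φ (φ.symm a) :
        EuclideanSpace ℂ (Fin d) →L[ℂ] EuclideanSpace ℂ (Fin d)) := by
    rintro k rfl
    exact (mdifferentiableAt_extChartAt hs).hasMFDerivAt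
  have hL : ContMDiff 𝓘(ℂ, EuclideanSpace ℂ (Fin d)) 𝓘(ℂ, EuclideanSpace ℂ (Fin d)) ω
      (fun y : G => φ.symm a * y) := contMDiff_mul_left
  have h1 := (hd (φ.symm a * 1) (mul_one _)).comp (1 : G)
    (hL.mdifferentiable (by simp) 1).hasMFDerivAt
  have h2 := h1.mfderiv.symm.trans h1.mdifferentiableAt.mfderiv
  refine (DFunLike.congr_fun h2 x).trans ?_
  change fderivWithin ℂ (writtenInExtChartAt 𝓘(ℂ, EuclideanSpace ℂ (Fin d))
    𝓘(ℂ, EuclideanSpace ℂ (Fin d)) 1 _) (Set.range 𝓘(ℂ, EuclideanSpace ℂ (Fin d))) _ _ = _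
  simp only [ModelWithCorners.range_eq_univ, fderivWithin_univ]
  rfl

theorem bracket_eq_lieBracket (x y : LieAlg d G) :
    @Eq (EuclideanSpace ℂ (Fin d)) (⁅x, y⁆ : LieAlg d G) (VectorField.lieBracket ℂ
      (fun a => fderiv ℂ (fun b => extChartAt 𝓘(ℂ, EuclideanSpace ℂ (Fin d)) (1 : G)
        ((extChartAt 𝓘(ℂ, EuclideanSpace ℂ (Fin d)) (1 : G)).symm a *
          (extChartAt 𝓘(ℂ, EuclideanSpace ℂ (Fin d)) (1 : G)).symm b))
        (extChartAt 𝓘(ℂ, EuclideanSpace ℂ (Fin d)) (1 : G) 1) x)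
      (fun a => fderiv ℂ (fun b => extChartAt 𝓘(ℂ, EuclideanSpace ℂ (Fin d)) (1 : G)
        ((extChartAt 𝓘(ℂ, EuclideanSpace ℂ (Fin d)) (1 : G)).symm a *
          (extChartAt 𝓘(ℂ, EuclideanSpace ℂ (Fin d)) (1 : G)).symm b))
        (extChartAt 𝓘(ℂ, EuclideanSpace ℂ (Fin d)) (1 : G) 1) y)
      (extChartAt 𝓘(ℂ, EuclideanSpace ℂ (Fin d)) (1 : G) 1)) := by
  have : IsManifold 𝓘(ℂ, EuclideanSpace ℂ (Fin d)) 1 G := IsManifold.of_le (n := ω) (by simp)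
  rw [GroupLieAlgebra.bracket_def, ← VectorField.mlieBracketWithin_univ,
    VectorField.mlieBracketWithin_apply, mfderiv_extChartAt_self]
  have hid : ∀ v : EuclideanSpace ℂ (Fin d), @Eq (EuclideanSpace ℂ (Fin d))
      ((ContinuousLinearMap.id ℂ (EuclideanSpace ℂ (Fin d))).inverse v) v := by
    intro v
    rw [ContinuousLinearMap.inverse_id]
    rfl
  refine (hid _).trans ?_
  have huniv : ∀ (V W : EuclideanSpace ℂ (Fin d) → EuclideanSpace ℂ (Fin d)) (s) (p), s = Set.univ →
      VectorField.lieBracketWithin ℂ V W s p = VectorField.lieBracket ℂ V W p := by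
    rintro V W _ p rfl
    rw [VectorField.lieBracketWithin_univ]
  refine (huniv _ _ _ _ (by simp)).trans ?_
  have hev := extChartAt_target_mem_nhds (I := 𝓘(ℂ, EuclideanSpace ℂ (Fin d))) (1 : G)
  refine Filter.EventuallyEq.lieBracket_vectorField_eq ?_ ?_
  · filter_upwards [hev] with a ha using mpullback_mulInvariantVectorField_chart x ha
  · filter_upwards [hev] with a ha using mpullback_mulInvariantVectorField_chart y ha

theorem hasFDerivAt_Ad (y : LieAlg d G) :
    ∃ A' : EuclideanSpace ℂ (Fin d) →L[ℂ] EuclideanSpace ℂ (Fin d),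
      HasFDerivAt (fun a => (Ad ((extChartAt 𝓘(ℂ, EuclideanSpace ℂ (Fin d)) (1 : G)).symm a) y :
        EuclideanSpace ℂ (Fin d))) A' (extChartAt 𝓘(ℂ, EuclideanSpace ℂ (Fin d)) (1 : G) 1) ∧
      ∀ x : LieAlg d G, @Eq (EuclideanSpace ℂ (Fin d)) (A' x) (⁅x, y⁆ : LieAlg d G) := by
  set φ := extChartAt 𝓘(ℂ, EuclideanSpace ℂ (Fin d)) (1 : G) with hφ
  set p := φ 1 with hp
  have : IsManifold 𝓘(ℂ, EuclideanSpace ℂ (Fin d)) 2 G := IsManifold.of_le (n := ω) (by simp)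
  have : LieGroup 𝓘(ℂ, EuclideanSpace ℂ (Fin d)) 2 G := LieGroup.of_le (n := ω) (by simp)
  have hp1 : φ.symm p = 1 := φ.left_inv (mem_extChartAt_source 1)
  have hsymm : ContMDiffAt 𝓘(ℂ, EuclideanSpace ℂ (Fin d)) 𝓘(ℂ, EuclideanSpace ℂ (Fin d)) 2
      φ.symm p := (contMDiffOn_extChartAt_symm (n := 2) (1 : G)).contMDiffAt
        ((isOpen_extChartAt_target (1 : G)).mem_nhds (mem_extChartAt_target 1))
  have hchart : ∀ g : G, g = 1 → ContMDiffAt 𝓘(ℂ, EuclideanSpace ℂ (Fin d))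
      𝓘(ℂ, EuclideanSpace ℂ (Fin d)) 2 φ g := by
    rintro g rfl
    exact contMDiffAt_extChartAt
  have hfst : ContMDiffAt 𝓘(ℂ, EuclideanSpace ℂ (Fin d) × EuclideanSpace ℂ (Fin d))
      𝓘(ℂ, EuclideanSpace ℂ (Fin d)) 2 (fun z : EuclideanSpace ℂ (Fin d) ×
        EuclideanSpace ℂ (Fin d) => φ.symm z.1) (p, p) :=
    ContMDiffAt.comp (p, p) hsymm contDiffAt_fst.contMDiffAt
  have hsnd : ContMDiffAt 𝓘(ℂ, EuclideanSpace ℂ (Fin d) × EuclideanSpace ℂ (Fin d))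
      𝓘(ℂ, EuclideanSpace ℂ (Fin d)) 2 (fun z : EuclideanSpace ℂ (Fin d) ×
        EuclideanSpace ℂ (Fin d) => φ.symm z.2) (p, p) :=
    ContMDiffAt.comp (p, p) hsymm contDiffAt_snd.contMDiffAt
  have hmul := hfst.mul hsnd
  have hconj := hmul.mul hfst.inv
  have hm : ContDiffAt ℂ 2 (fun z : EuclideanSpace ℂ (Fin d) × EuclideanSpace ℂ (Fin d) =>
      φ (φ.symm z.1 * φ.symm z.2)) (p, p) := by
    refine contMDiffAt_iff_contDiffAt.mp (ContMDiffAt.comp (p, p) (hchart _ ?_) hmul)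
    simp [hp1]
  have hc : ContDiffAt ℂ 2 (fun z : EuclideanSpace ℂ (Fin d) × EuclideanSpace ℂ (Fin d) =>
      φ (φ.symm z.1 * φ.symm z.2 * (φ.symm z.1)⁻¹)) (p, p) := by
    refine contMDiffAt_iff_contDiffAt.mp (ContMDiffAt.comp (p, p) (hchart _ ?_) hconj)
    simp [hp1]
  have htarget : ∀ᶠ a in 𝓝 p, a ∈ φ.target := extChartAt_target_mem_nhds (1 : G)
  have hsource : ∀ᶠ z in 𝓝 (p, p), φ.symm z.1 * φ.symm z.2 * (φ.symm z.1)⁻¹ ∈ φ.source := by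
    have h1 : φ.symm p * φ.symm p * (φ.symm p)⁻¹ = 1 := by simp [hp1]
    exact hconj.continuousAt.preimage_mem_nhds (t := φ.source)
      (by
        change φ.source ∈ 𝓝 (φ.symm p * φ.symm p * (φ.symm p)⁻¹)
        rw [h1]
        exact extChartAt_source_mem_nhds (1 : G))
  obtain ⟨A', hA1, hA2⟩ := hasFDerivAt_conj_of_local_group hm hc
    (by filter_upwards [htarget] with b hb; simp [hp1, φ.right_inv hb])
    (by filter_upwards [htarget] with b hb; simp [hp1, φ.right_inv hb])
    (by filter_upwards [htarget] with b hb; simp [hp1, φ.right_inv hb])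
    (by filter_upwards [htarget] with b hb; simp only [hp1]; simp [hp])
    (by filter_upwards [hsource] with z hz; simp [φ.left_inv hz])
    (y : EuclideanSpace ℂ (Fin d))
  refine ⟨A', ?_, fun x => (hA2 x).trans (bracket_eq_lieBracket x y).symm⟩
  refine hA1.congr_of_eventuallyEq (Eventually.of_forall fun a => ?_)
  exact mfderiv_at_one_eq_fderiv (fun k : G => φ.symm a * k * (φ.symm a)⁻¹) (by simp)
    (mdifferentiable_conj _ 1) y

theorem dirDeriv_Ad (l : Module.Dual ℂ (LieAlg d G)) (x y : LieAlg d G) :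
    MDifferentiableAt 𝓘(ℂ, EuclideanSpace ℂ (Fin d)) 𝓘(ℂ, ℂ) (fun g : G => l (Ad g y)) 1 ∧
      dirDeriv x (fun g : G => l (Ad g y)) = l ⁅x, y⁆ := by
  set φ := extChartAt 𝓘(ℂ, EuclideanSpace ℂ (Fin d)) (1 : G) with hφ
  have hp1 : φ.symm (φ 1) = 1 := φ.left_inv (mem_extChartAt_source 1)
  obtain ⟨A', hA1, hA2⟩ := hasFDerivAt_Ad y
  let l' : EuclideanSpace ℂ (Fin d) →L[ℂ] ℂ :=
    LinearMap.toContinuousLinearMap (show EuclideanSpace ℂ (Fin d) →ₗ[ℂ] ℂ from l)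
  have h1 : HasFDerivAt (fun a => l' (Ad (φ.symm a) y)) (l' ∘L A') (φ 1) :=
    l'.hasFDerivAt.comp _ hA1
  have hm : HasMFDerivAt 𝓘(ℂ, EuclideanSpace ℂ (Fin d)) 𝓘(ℂ, ℂ) (fun g : G => l (Ad g y)) 1
      (l' ∘L A') := by
    constructor
    · have h2 : ContinuousAt ((fun a => l' (Ad (φ.symm a) y)) ∘ φ) (1 : G) :=
        ContinuousAt.comp h1.continuousAt (continuousAt_extChartAt (1 : G))
      refine h2.congr ?_
      filter_upwards [extChartAt_source_mem_nhds (I := 𝓘(ℂ, EuclideanSpace ℂ (Fin d))) (1 : G)]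
        with g hg
      simp only [Function.comp_apply]
      rw [φ.left_inv hg]
      rfl
    · exact h1.hasFDerivWithinAt
  refine ⟨hm.mdifferentiableAt, ?_⟩
  have h3 := DFunLike.congr_fun hm.mfderiv x
  refine Eq.trans h3 ?_
  exact congrArg l (hA2 x)

end AdjointDerivative

/-! ### The adjoint action and Hamiltonian vectors on the cover. -/

section AdjointAction

variable {d : ℕ} {G : Type*} [TopologicalSpace G] [ChartedSpace (EuclideanSpace ℂ (Fin d)) G]
  [Group G]

instance : FiniteDimensional ℂ (LieAlg d G) :=
  inferInstanceAs (FiniteDimensional ℂ (EuclideanSpace ℂ (Fin d)))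

variable [LieGroup 𝓘(ℂ, EuclideanSpace ℂ (Fin d)) ω G]

/-- The linear map `Ad g`. -/
noncomputable def AdL (g : G) : LieAlg d G →ₗ[ℂ] LieAlg d G where
  toFun := Ad g
  map_add' x y := by
    have h : g * 1 * g⁻¹ = 1 := by simp
    have := map_add (mfderiv 𝓘(ℂ, EuclideanSpace ℂ (Fin d)) 𝓘(ℂ, EuclideanSpace ℂ (Fin d))
      (fun y : G => g * y * g⁻¹) 1) x y
    exact this
  map_smul' c x := by
    have := map_smul (mfderiv 𝓘(ℂ, EuclideanSpace ℂ (Fin d)) 𝓘(ℂ, EuclideanSpace ℂ (Fin d))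
      (fun y : G => g * y * g⁻¹) 1) c x
    exact this

theorem AdL_apply (g : G) (x : LieAlg d G) : AdL g x = Ad g x := rfl

/-- The derivative of a function precomposed with a conjugation. -/
theorem dirDeriv_comp_conj (x : LieAlg d G) (g : G) {f : G → ℂ}
    (hf : MDifferentiableAt 𝓘(ℂ, EuclideanSpace ℂ (Fin d)) 𝓘(ℂ, ℂ) f 1) :
    dirDeriv x (fun k => f (g * k * g⁻¹)) = dirDeriv (Ad g x) f := by
  have h1 : ∀ k : G, k = 1 → HasMFDerivAt 𝓘(ℂ, EuclideanSpace ℂ (Fin d)) 𝓘(ℂ, ℂ) f k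
      (mfderiv 𝓘(ℂ, EuclideanSpace ℂ (Fin d)) 𝓘(ℂ, ℂ) f 1 : EuclideanSpace ℂ (Fin d) →L[ℂ] ℂ) := by
    rintro k rfl
    exact hf.hasMFDerivAt
  have h2 := (h1 (g * 1 * g⁻¹) (by simp)).comp (1 : G) (mdifferentiable_conj g 1).hasMFDerivAt
  exact DFunLike.congr_fun h2.mfderiv x

/-- Differentiate `Ad(g) Ad(k) y = Ad(g k g⁻¹) Ad(g) y` in `k` at the identity. -/
theorem Ad_lie (g : G) (x y : LieAlg d G) : Ad g ⁅x, y⁆ = ⁅Ad g x, Ad g y⁆ := by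
  rw [← sub_eq_zero, ← Module.forall_dual_apply_eq_zero_iff ℂ]
  intro l
  rw [map_sub, sub_eq_zero]
  have h1 := (dirDeriv_Ad (l ∘ₗ AdL g) x y).2
  have h2 := dirDeriv_comp_conj x g (dirDeriv_Ad l x (Ad g y)).1
  rw [(dirDeriv_Ad l (Ad g x) (Ad g y)).2] at h2
  rw [← h2]
  refine h1.symm.trans ?_
  congr 1
  funext k
  simp only [LinearMap.comp_apply, AdL_apply]
  rw [← Ad_mul, ← Ad_mul]
  simp

namespace GaloisOrbitCover

variable (X : GaloisOrbitCover d G)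

theorem κ_smul (g : G) (m : X.M) : X.κ (g • m) = Ad g (X.κ m) := by
  induction m using QuotientGroup.induction_on with
  | H a => exact Ad_mul g a X.e

theorem vderiv_φ (x z : LieAlg d G) (m : X.M) : X.vderiv z (X.φ x) m = X.kks m x z := by
  have h := (dirDeriv_Ad (killingForm ℂ (LieAlg d G) x) z (X.κ m)).2
  rw [vderiv_eq_dirDeriv]
  simp only [φ, κ_smul]
  rw [h, kks, ← LieModule.traceForm_apply_lie_apply, LieModule.traceForm_comm]

theorem isHamiltonianAt_φ (x : LieAlg d G) (m : X.M) : X.IsHamiltonianAt (X.φ x) m x :=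
  fun z => X.vderiv_φ x z m

theorem vderiv_actG (g : G) (f : X.R) (x : LieAlg d G) (m : X.M) :
    X.vderiv x (X.actG g f : X.R) m = X.vderiv (Ad g⁻¹ x) f (g⁻¹ • m) := by
  rw [vderiv_eq_dirDeriv, vderiv_eq_dirDeriv, ← dirDeriv_comp_conj x g⁻¹ (X.hol_orbit f _ 1)]
  congr 1
  funext k
  change (f : X.M → ℂ) (g⁻¹ • k • m) = _
  simp [smul_smul, mul_assoc]

theorem actG_apply (g : G) (f : X.R) (m : X.M) :
    (X.actG g f : X.M → ℂ) m = (f : X.M → ℂ) (g⁻¹ • m) := rfl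

theorem actG_mem_gr (g : G) {n : ℤ} {f : X.R} (hf : f ∈ X.gr n) : X.actG g f ∈ X.gr n := by
  intro m x hx
  rw [vderiv_actG, actG_apply]
  refine hf (g⁻¹ • m) (Ad g⁻¹ x) ?_
  rw [κ_smul, ← Ad_lie, hx]

/-- The base point. -/
def basePoint : X.M := ((1 : G) : X.M)

theorem exists_smul_eq (m m' : X.M) : ∃ g : G, g • m = m' := MulAction.exists_smul_eq G m m'

theorem kks_add_left (m : X.M) (x y z : LieAlg d G) :
    X.kks m (x + y) z = X.kks m x z + X.kks m y z := by simp [kks]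

theorem kks_smul_left (m : X.M) (c : ℂ) (x z : LieAlg d G) :
    X.kks m (c • x) z = c * X.kks m x z := by simp [kks]

theorem kks_swap (m : X.M) (x z : LieAlg d G) : X.kks m x z = - X.kks m z x := by
  rw [kks, ← lie_skew, map_neg]; rfl

/-- `f` has a Hamiltonian vector at `m`. -/
def HasHamiltonianAt (f : X.R) (m : X.M) : Prop := ∃ x, X.IsHamiltonianAt f m x

variable {X}

theorem HasHamiltonianAt.add {f g : X.R} {m : X.M} (hf : X.HasHamiltonianAt f m)
    (hg : X.HasHamiltonianAt g m) : X.HasHamiltonianAt (f + g) m := by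
  obtain ⟨x, hx⟩ := hf
  obtain ⟨y, hy⟩ := hg
  refine ⟨x + y, fun z => ?_⟩
  rw [kks_add_left, ← hx, ← hy]
  exact (X.vderivL z m).map_add f g

theorem HasHamiltonianAt.smul {f : X.R} {m : X.M} (hf : X.HasHamiltonianAt f m) (c : ℂ) :
    X.HasHamiltonianAt (c • f) m := by
  obtain ⟨x, hx⟩ := hf
  refine ⟨c • x, fun z => ?_⟩
  rw [kks_smul_left, ← hx]
  exact (X.vderivL z m).map_smul c f

/-- Quotient rule: `df = (d(fg) - f dg) / g` where `g` does not vanish. -/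
theorem HasHamiltonianAt.of_mul {f g : X.R} {m : X.M} (hfg : X.HasHamiltonianAt (f * g) m)
    (hg : X.HasHamiltonianAt g m) (hne : (g : X.M → ℂ) m ≠ 0) : X.HasHamiltonianAt f m := by
  obtain ⟨x, hx⟩ := hfg
  obtain ⟨y, hy⟩ := hg
  refine ⟨((g : X.M → ℂ) m)⁻¹ • (x + (-(f : X.M → ℂ) m) • y), fun z => ?_⟩
  rw [kks_smul_left, kks_add_left, kks_smul_left, ← hx, ← hy, vderiv_mul]
  field_simp
  ring

theorem hasHamiltonianAt_zero (m : X.M) : X.HasHamiltonianAt 0 m :=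
  ⟨0, fun z => by
    rw [← vderivL_apply, map_zero]
    simp [kks]⟩

theorem kks_hamiltonian {f : X.R} {m : X.M} (h : X.HasHamiltonianAt f m) (z : LieAlg d G) :
    X.kks m (X.hamiltonian f m) z = X.vderiv z f m := by
  have h' : ∃ x, X.IsHamiltonianAt f m x := h
  rw [hamiltonian, dif_pos h']
  exact (h'.choose_spec z).symm

theorem kks_hamiltonian_φ (x : LieAlg d G) (m : X.M) (z : LieAlg d G) :
    X.kks m (X.hamiltonian (X.φ x) m) z = X.kks m x z := by
  have h' : ∃ y, X.IsHamiltonianAt (X.φ x) m y := ⟨x, X.isHamiltonianAt_φ x m⟩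
  rw [hamiltonian, dif_pos h']
  exact (h'.choose_spec z).symm.trans (X.vderiv_φ x z m)

theorem poisson_φ_of_hasHamiltonianAt (x : LieAlg d G) {f : X.R} {m : X.M}
    (h : X.HasHamiltonianAt f m) : X.poisson (X.φ x) f m = - X.vderiv x f m := by
  rw [poisson, kks_hamiltonian_φ, kks_swap, kks_hamiltonian h]

/-- The default value `0` of `hamiltonian` enters here; `hasHamiltonianAt_of_apply_ne_zero` shows
that it contradicts the Leibniz rule. -/
theorem poisson_φ_of_not_hasHamiltonianAt (x : LieAlg d G) {f : X.R} {m : X.M}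
    (h : ¬ X.HasHamiltonianAt f m) : X.poisson (X.φ x) f m = 0 := by
  have h' : ¬ ∃ x, X.IsHamiltonianAt f m x := h
  rw [poisson, hamiltonian, hamiltonian, dif_neg h']
  simp [kks]

theorem κ_ne_zero [Nontrivial (LieAlg d G)] (m : X.M) : X.κ m ≠ 0 := by
  intro h0
  obtain ⟨g, hg⟩ := X.exists_smul_eq m X.basePoint
  have he : X.e = 0 := by
    have h1 : X.κ X.basePoint = X.e := Ad_one X.e
    rw [← h1, ← hg, κ_smul, h0]
    exact map_zero (AdL g)
  have h2 : Submodule.span ℂ (Set.range fun g : G => Ad g X.e) = ⊥ := by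
    rw [Submodule.span_eq_bot]
    rintro _ ⟨g, rfl⟩
    rw [he]
    exact map_zero (AdL g)
  rw [X.spans] at h2
  exact top_ne_bot h2

theorem exists_φ_ne_zero [LieAlgebra.IsKilling ℂ (LieAlg d G)] [Nontrivial (LieAlg d G)]
    (m : X.M) : ∃ x y : LieAlg d G, X.φ y m ≠ 0 ∧ X.φ ⁅x, y⁆ m ≠ 0 := by
  have hκ := X.κ_ne_zero m
  have hnd := (LieAlgebra.IsKilling.killingForm_nondegenerate ℂ (LieAlg d G)).1
  -- The Killing orthogonal and the centralizer of `κ(m)` are proper subspaces, and two proper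
  -- subspaces do not cover `𝔤`.
  obtain ⟨y, h1, h2⟩ : ∃ y : LieAlg d G, killingForm ℂ (LieAlg d G) (X.κ m) y ≠ 0 ∧ ⁅X.κ m, y⁆ ≠ 0 := by
    obtain ⟨y₁, hy₁⟩ : ∃ y : LieAlg d G, killingForm ℂ (LieAlg d G) (X.κ m) y ≠ 0 := by
      by_contra! h
      exact hκ (hnd _ h)
    obtain ⟨y₂, hy₂⟩ : ∃ y : LieAlg d G, ⁅X.κ m, y⁆ ≠ 0 := by
      by_contra! h
      have : X.κ m ∈ LieAlgebra.center ℂ (LieAlg d G) := by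
        rw [LieModule.mem_maxTrivSubmodule]
        intro y
        rw [← lie_skew, h, neg_zero]
      rw [LieAlgebra.center_eq_bot] at this
      exact hκ (by simpa using this)
    by_cases hb : ⁅X.κ m, y₁⁆ = 0
    · by_cases hk : killingForm ℂ (LieAlg d G) (X.κ m) y₂ = 0
      · exact ⟨y₁ + y₂, by rw [map_add, hk, add_zero]; exact hy₁, by
          rw [lie_add, hb, zero_add]; exact hy₂⟩
      · exact ⟨y₂, hk, hy₂⟩
    · exact ⟨y₁, hy₁, hb⟩
  obtain ⟨x, hx⟩ : ∃ x : LieAlg d G, killingForm ℂ (LieAlg d G) ⁅X.κ m, y⁆ x ≠ 0 := by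
    by_contra! h
    exact h2 (hnd _ h)
  refine ⟨x, y, ?_, ?_⟩
  · rw [φ, LieModule.traceForm_comm]
    exact h1
  · rw [φ, LieModule.traceForm_comm, ← lie_skew, map_neg, ← LieModule.traceForm_apply_lie_apply]
    exact neg_ne_zero.mpr hx

end GaloisOrbitCover

end AdjointAction

/-! ### Symbols, the Euler grading and the `𝔤`-action on `D`. -/

namespace PerfectDixmierAlgebra

open Module

variable {d : ℕ} {G : Type*} [TopologicalSpace G] [ChartedSpace (EuclideanSpace ℂ (Fin d)) G]
  [Group G] [LieGroup 𝓘(ℂ, EuclideanSpace ℂ (Fin d)) ω G] {X : GaloisOrbitCover d G}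
  {D : Type*} [Ring D] [Algebra ℂ D] (A : PerfectDixmierAlgebra X D)

/-- The symbol map `F n → R`. -/
noncomputable def symbol (n : ℤ) : A.F n →ₗ[ℂ] X.R := A.γ.toLinearMap ∘ₗ grMk A.F n

theorem symbol_apply (n : ℤ) (a : A.F n) : A.symbol n a = A.γ (grMk A.F n a) := rfl

theorem symbol_eq_zero_iff {n : ℤ} {a : A.F n} : A.symbol n a = 0 ↔ (a : D) ∈ A.F (n - 1) := by
  rw [symbol_apply, LinearEquiv.map_eq_zero_iff, grMk, LinearMap.comp_apply,
    LinearMap.map_eq_zero_iff _ (DirectSum.of_injective n), Submodule.mkQ_apply,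
    Submodule.Quotient.mk_eq_zero]
  rfl

theorem range_symbol (n : ℤ) : LinearMap.range (A.symbol n) = X.gr n := by
  rw [symbol, LinearMap.range_comp, A.γ_graded]

theorem symbol_mem (n : ℤ) (a : A.F n) : A.symbol n a ∈ X.gr n := by
  rw [← A.range_symbol]; exact ⟨a, rfl⟩

theorem exists_symbol_eq {n : ℤ} {f : X.R} (hf : f ∈ X.gr n) : ∃ a, A.symbol n a = f := by
  rw [← A.range_symbol] at hf; exact hf

theorem symbol_mul {m n k : ℤ} (hk : k = m + n) (a : A.F m) (b : A.F n) (c : A.F k)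
    (h : (c : D) = a * b) : A.symbol k c = A.symbol m a * A.symbol n b := by
  subst hk
  exact A.γ_mul m n a b c h

theorem symbol_poisson {m n k : ℤ} (hk : k = m + n - 2) (a : A.F m) (b : A.F n) (c : A.F k)
    (h : (c : D) = a * b - b * a) :
    (A.symbol k c : X.M → ℂ) = X.poisson (A.symbol m a : X.R) (A.symbol n b : X.R) := by
  subst hk
  exact A.γ_poisson m n a b c h

theorem symbol_ψ (x : LieAlg d G) :
    (A.symbol 2 ⟨A.ψ x, A.ψ_mem_F x⟩ : X.M → ℂ) = X.φ x := A.γ_ψ x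

/-- The grading of `gr D` is direct by construction, and `γ` maps its components isomorphically onto
the spaces `X.gr n`. -/
theorem isInternal_gr (A : PerfectDixmierAlgebra X D) : DirectSum.IsInternal X.gr := by
  let Q : ℤ → Type _ := fun n => A.F n ⧸ (A.F (n - 1)).submoduleOf (A.F n)
  have hmem : ∀ n (v : Q n), A.γ (DirectSum.lof ℂ ℤ Q n v) ∈ X.gr n := by
    intro n v
    obtain ⟨a, rfl⟩ := Submodule.mkQ_surjective _ v
    exact A.symbol_mem n a
  let e : ∀ n, Q n ≃ₗ[ℂ] X.gr n := fun n =>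
    LinearEquiv.ofBijective
      ((A.γ.toLinearMap ∘ₗ DirectSum.lof ℂ ℤ Q n).codRestrict (X.gr n) (hmem n)) (by
        constructor
        · intro v w h
          have h' : A.γ (DirectSum.lof ℂ ℤ Q n v) = A.γ (DirectSum.lof ℂ ℤ Q n w) :=
            congrArg Subtype.val h
          exact DirectSum.of_injective n (A.γ.injective h')
        · rintro ⟨f, hf⟩
          obtain ⟨a, rfl⟩ := A.exists_symbol_eq hf
          exact ⟨Submodule.mkQ _ a, rfl⟩)
  have key : (DirectSum.coeLinearMap X.gr) ∘ₗ (DFinsupp.mapRange.linearEquiv e).toLinearMap =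
      A.γ.toLinearMap := by
    refine DirectSum.linearMap_ext ℂ fun n => LinearMap.ext fun v => ?_
    change DirectSum.coeLinearMap X.gr (DFinsupp.mapRange.linearEquiv e (DFinsupp.single n v)) =
      A.γ (DirectSum.lof ℂ ℤ Q n v)
    rw [DFinsupp.mapRange.linearEquiv_apply, DFinsupp.mapRange_single]
    exact DirectSum.coeLinearMap_lof X.gr n (e n v)
  have h : Function.Bijective ((DirectSum.coeLinearMap X.gr) ∘ₗ
      (DFinsupp.mapRange.linearEquiv e).toLinearMap) := by
    rw [key]
    exact A.γ.bijective
  rw [LinearMap.coe_comp] at h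
  exact (Function.Bijective.of_comp_iff _ (DFinsupp.mapRange.linearEquiv e).bijective).mp h

/-- The `𝔤`-action on `D` by inner derivations. -/
noncomputable def adRep : LieAlg d G →ₗ[ℂ] End ℂ D :=
  (LinearMap.mul ℂ D - (LinearMap.mul ℂ D).flip) ∘ₗ A.ψ

theorem adRep_apply (x : LieAlg d G) (a : D) : A.adRep x a = A.ψ x * a - a * A.ψ x := rfl

theorem isLieRep_adRep : IsLieRep A.adRep := by
  intro x y
  ext a
  simp only [LinearMap.sub_apply, End.mul_apply, adRep_apply, A.ψ_lie]
  noncomm_ring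

theorem isLocallyFinite_adRep : IsLocallyFinite A.adRep := by
  intro a
  obtain ⟨V, h1, h2, h3, -⟩ := A.locally_finite a
  exact ⟨V, h1, h2, h3⟩

theorem adRep_mem_F (n : ℤ) (x : LieAlg d G) (a : D) (ha : a ∈ A.F n) : A.adRep x a ∈ A.F n := by
  have := A.commutator_mem_F 2 n (A.ψ x) a (A.ψ_mem_F x) ha
  rwa [show 2 + n - 2 = n by ring] at this

/-- The `𝔤`-action on a filtration space. -/
noncomputable def adRepF (n : ℤ) : LieAlg d G →ₗ[ℂ] End ℂ (A.F n) :=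
  restrictRep A.adRep (A.F n) (A.adRep_mem_F n)

theorem isLieRep_adRepF (n : ℤ) : IsLieRep (A.adRepF n) := A.isLieRep_adRep.restrict _ _

theorem isLocallyFinite_adRepF (n : ℤ) : IsLocallyFinite (A.adRepF n) := by
  intro a
  obtain ⟨V, h1, h2, h3⟩ := A.isLocallyFinite_adRep (a : D)
  have : FiniteDimensional ℂ V := Module.Finite.iff_fg.mpr h1
  refine ⟨V.submoduleOf (A.F n), ?_, h2, fun x b hb => h3 x _ hb⟩
  rw [← Module.Finite.iff_fg]
  let j : V.submoduleOf (A.F n) →ₗ[ℂ] V :=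
    { toFun := fun v => ⟨(v : A.F n), v.2⟩
      map_add' := fun _ _ => rfl
      map_smul' := fun _ _ => rfl }
  refine Module.Finite.of_injective j fun v w h => ?_
  have h' : ((j v : V) : D) = (j w : V) := congrArg Subtype.val h
  exact Subtype.ext (Subtype.ext h')

theorem symbol_adRepF (n : ℤ) (x : LieAlg d G) (a : A.F n) :
    (A.symbol n (A.adRepF n x a) : X.M → ℂ) = X.poisson (X.φ x) (A.symbol n a : X.R) := by
  rw [A.symbol_poisson (m := 2) (by ring) ⟨A.ψ x, A.ψ_mem_F x⟩ a _ rfl, symbol_ψ]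

variable [LieAlgebra.IsKilling ℂ (LieAlg d G)]

/-- If `f` had no Hamiltonian vector at `m`, neither would `f φ^y` when `φ^y(m) ≠ 0`. Then `{φ^x,
f}` and `{φ^x, f φ^y}` would both vanish at `m`. But these brackets are symbols of commutators,
which obey the Leibniz rule, so `f(m) φ^{[x,y]}(m) = 0`, which fails for suitable `x` and `y`. -/
theorem hasHamiltonianAt_of_apply_ne_zero (A : PerfectDixmierAlgebra X D) [Nontrivial (LieAlg d G)] {n : ℤ} {f : X.R}
    (hf : f ∈ X.gr n) (m : X.M) (hne : (f : X.M → ℂ) m ≠ 0) : X.HasHamiltonianAt f m := by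
  obtain ⟨b, rfl⟩ := A.exists_symbol_eq hf
  by_contra hbad
  obtain ⟨x, y, hy, hxy⟩ := GaloisOrbitCover.exists_φ_ne_zero (X := X) m
  set py : A.F 2 := ⟨A.ψ y, A.ψ_mem_F y⟩ with hpy
  set pxy : A.F 2 := ⟨A.ψ ⁅x, y⁆, A.ψ_mem_F _⟩ with hpxy
  have hφy : (A.symbol 2 py : X.M → ℂ) = X.φ y := A.symbol_ψ y
  have hφxy : (A.symbol 2 pxy : X.M → ℂ) = X.φ ⁅x, y⁆ := A.symbol_ψ _
  let c : A.F (n + 2) := ⟨b * py, A.mul_mem_F _ _ _ _ b.2 py.2⟩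
  have hc : A.symbol (n + 2) c = A.symbol n b * A.symbol 2 py := A.symbol_mul rfl b py c rfl
  have hcbad : ¬ X.HasHamiltonianAt (A.symbol (n + 2) c) m := by
    intro h
    rw [hc] at h
    refine hbad (h.of_mul ⟨y, ?_⟩ ?_)
    · rw [hφy]
      exact X.isHamiltonianAt_φ y m
    · rw [hφy]
      exact hy
  have h1 : (A.symbol n (A.adRepF n x b) : X.M → ℂ) m = 0 := by
    rw [symbol_adRepF, GaloisOrbitCover.poisson_φ_of_not_hasHamiltonianAt x hbad]
  have h2 : (A.symbol (n + 2) (A.adRepF (n + 2) x c) : X.M → ℂ) m = 0 := by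
    rw [symbol_adRepF, GaloisOrbitCover.poisson_φ_of_not_hasHamiltonianAt x hcbad]
  let c₁ : A.F (n + 2) := ⟨A.adRepF n x b * py, A.mul_mem_F _ _ _ _ (A.adRepF n x b).2 py.2⟩
  let c₂ : A.F (n + 2) := ⟨b * pxy, A.mul_mem_F _ _ _ _ b.2 pxy.2⟩
  have h3 : A.adRepF (n + 2) x c = c₁ + c₂ := by
    ext
    change A.ψ x * (b * A.ψ y) - (b * A.ψ y) * A.ψ x =
      (A.ψ x * b - b * A.ψ x) * A.ψ y + b * A.ψ ⁅x, y⁆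
    rw [A.ψ_lie]
    noncomm_ring
  rw [h3, map_add, A.symbol_mul rfl (A.adRepF n x b) py c₁ rfl, A.symbol_mul rfl b pxy c₂ rfl] at h2
  change (A.symbol n (A.adRepF n x b) : X.M → ℂ) m * (A.symbol 2 py : X.M → ℂ) m +
    (A.symbol n b : X.M → ℂ) m * (A.symbol 2 pxy : X.M → ℂ) m = 0 at h2
  rw [h1, hφxy, zero_mul, zero_add] at h2
  exact (mul_ne_zero hne hxy) h2

theorem hasHamiltonianAt (A : PerfectDixmierAlgebra X D) {n : ℤ} {f : X.R} (hf : f ∈ X.gr n) (m : X.M) :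
    X.HasHamiltonianAt f m := by
  rcases subsingleton_or_nontrivial (LieAlg d G) with hs | hn
  · refine ⟨0, fun z => ?_⟩
    have hz : z = (0 : ℂ) • z := Subsingleton.elim _ _
    rw [hz, GaloisOrbitCover.vderiv_eq_dirDeriv, dirDeriv_smul_left]
    simp [GaloisOrbitCover.kks]
  -- If the whole degree vanishes at `m`, it vanishes everywhere by homogeneity. Otherwise a zero of
  -- `f` at `m` is removed by adding some `f'` of the same degree that is nonzero at `m`.
  by_cases h : ∀ f' ∈ X.gr n, (f' : X.M → ℂ) m = 0
  · have hf0 : f = 0 := by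
      ext m'
      obtain ⟨g, rfl⟩ := X.exists_smul_eq m m'
      have := h _ (X.actG_mem_gr g⁻¹ hf)
      rw [GaloisOrbitCover.actG_apply, inv_inv] at this
      exact this
    rw [hf0]
    exact GaloisOrbitCover.hasHamiltonianAt_zero m
  · push Not at h
    obtain ⟨f', hf', hne⟩ := h
    by_cases hfm : (f : X.M → ℂ) m = 0
    · have h1 := A.hasHamiltonianAt_of_apply_ne_zero (add_mem hf hf') m (by
        change (f : X.M → ℂ) m + (f' : X.M → ℂ) m ≠ 0
        rwa [hfm, zero_add])
      have h2 := A.hasHamiltonianAt_of_apply_ne_zero hf' m hne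
      have h3 := h1.add (h2.smul (-1))
      rwa [neg_one_smul, add_neg_cancel_right] at h3
    · exact A.hasHamiltonianAt_of_apply_ne_zero hf m hfm

/-- The symbol map intertwines the `𝔤`-action on `D` with the one on functions. -/
theorem symbol_adRepF_apply (n : ℤ) (x : LieAlg d G) (a : A.F n) (m : X.M) :
    (A.symbol n (A.adRepF n x a) : X.M → ℂ) m = - X.vderiv x (A.symbol n a : X.R) m := by
  rw [symbol_adRepF, GaloisOrbitCover.poisson_φ_of_hasHamiltonianAt x
    (A.hasHamiltonianAt (A.symbol_mem n a) m)]

end PerfectDixmierAlgebra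

/-! ### Finiteness of multiplicities. -/

theorem finiteDimensional_of_injective_ker {K E N E' : Type*} [Field K] [AddCommGroup E] [Module K E]
    [AddCommGroup N] [Module K N] [AddCommGroup E'] [Module K E'] [FiniteDimensional K N]
    [FiniteDimensional K E'] (f : E →ₗ[K] N) (κ : LinearMap.ker f →ₗ[K] E')
    (hκ : Function.Injective κ) : FiniteDimensional K E := by
  have fd : FiniteDimensional K (LinearMap.ker f) := FiniteDimensional.of_injective κ hκ
  refine ⟨Submodule.fg_of_fg_map_of_fg_inf_ker f (IsNoetherian.noetherian _) ?_⟩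
  rw [top_inf_eq]
  exact Module.Finite.iff_fg.mp fd

namespace PerfectDixmierAlgebra

open Module

variable {d : ℕ} {G : Type*} [TopologicalSpace G] [ChartedSpace (EuclideanSpace ℂ (Fin d)) G]
  [Group G] [LieGroup 𝓘(ℂ, EuclideanSpace ℂ (Fin d)) ω G] {X : GaloisOrbitCover d G}
  {D : Type*} [Ring D] [Algebra ℂ D] (A : PerfectDixmierAlgebra X D)

/-- The action of `G` on an invariant subspace of `D`. -/
def restrictρ (W : Submodule ℂ D) (hW : ∀ g, ∀ b ∈ W, A.ρ g b ∈ W) : G →* End ℂ W where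
  toFun g := (A.ρ g).toLinearMap.restrict (hW g)
  map_one' := by
    ext w
    simp [LinearMap.restrict_apply]
  map_mul' g h := by
    refine LinearMap.ext fun w => Subtype.ext ?_
    change A.ρ (g * h) w = A.ρ g (A.ρ h w)
    rw [map_mul]
    rfl

theorem isHolRep_restrictρ (W : Submodule ℂ D) (hW : ∀ g, ∀ b ∈ W, A.ρ g b ∈ W)
    (hW' : ∀ x, ∀ b ∈ W, A.adRep x b ∈ W) :
    IsHolRep (A.restrictρ W hW) (restrictRep A.adRep W hW') := by
  constructor
  · intro l v
    obtain ⟨l', rfl⟩ := l.exists_extend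
    exact A.ρ_holomorphic v l'
  · intro l v x
    obtain ⟨l', rfl⟩ := l.exists_extend
    exact A.ρ_deriv v l' x

theorem adRep_eq_zero_of_ρ_invariant (l : Dual ℂ D) (hl : ∀ g a, l (A.ρ g a) = l a)
    (x : LieAlg d G) (a : D) : l (A.adRep x a) = 0 := by
  have h : (fun g : G => l (A.ρ g a)) = fun _ => l a := funext fun g => hl g a
  refine (A.ρ_deriv a l x).symm.trans ?_
  change dirDeriv x (fun g : G => l (A.ρ g a)) = 0
  rw [h, dirDeriv_const]

variable [LieAlgebra.IsKilling ℂ (LieAlg d G)]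

/-- Frobenius reciprocity along the filtration: composed with the symbol map, an intertwiner becomes
a `G`-map to functions on `M`, hence is determined by a functional on `V`, its value at the base
point. When that functional is zero, the intertwiner takes values in `F (n - 1)`, and induction
applies. -/
theorem finiteDimensional_intertwiners [PreconnectedSpace G] {V : Type*} [AddCommGroup V]
    [Module ℂ V] [FiniteDimensional ℂ V] {π : G →* End ℂ V} {θ : LieAlg d G →ₗ[ℂ] End ℂ V}
    (h : IsHolRep π θ) (n : ℤ) : FiniteDimensional ℂ (intertwiners θ (A.adRepF n)) := by
  obtain ⟨k, hk⟩ : ∃ k : ℕ, n < k := ⟨n.toNat + 1, by push_cast; omega⟩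
  induction k generalizing n with
  | zero =>
    have h0 : A.F n = ⊥ := A.F_neg n (by exact_mod_cast hk)
    have : Subsingleton (intertwiners θ (A.adRepF n)) := by
      refine ⟨fun f g => Subtype.ext (LinearMap.ext fun v => Subtype.ext ?_)⟩
      have h1 := (f.1 v).2
      have h2 := (g.1 v).2
      have h3 : ∀ a ∈ A.F n, a = 0 := fun a ha => by rwa [h0, Submodule.mem_bot] at ha
      rw [h3 _ h1, h3 _ h2]
    infer_instance
  | succ k ih =>
    have := ih (n - 1) (by push_cast at hk; omega)
    let ev : intertwiners θ (A.adRepF n) →ₗ[ℂ] Dual ℂ V :=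
      { toFun := fun f => X.evalL X.basePoint ∘ₗ A.symbol n ∘ₗ f.1
        map_add' := fun f g => by ext; simp
        map_smul' := fun c f => by ext; simp }
    have hker : ∀ f ∈ LinearMap.ker ev, ∀ v, (f.1 v : D) ∈ A.F (n - 1) := by
      intro f hf v
      rw [← A.symbol_eq_zero_iff]
      ext m
      obtain ⟨g, rfl⟩ := X.exists_smul_eq X.basePoint m
      have h1 := X.apply_smul_of_infinitesimally_equivariant h (A.symbol n ∘ₗ f.1)
        (fun x v m => by
          rw [LinearMap.comp_apply, f.2 x v, A.symbol_adRepF_apply]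
          rfl) g (π g⁻¹ v) X.basePoint
      have h2 : π g (π g⁻¹ v) = v := by rw [← Module.End.mul_apply, ← map_mul]; simp
      rw [h2] at h1
      exact h1.trans (LinearMap.congr_fun hf (π g⁻¹ v))
    let κ : LinearMap.ker ev →ₗ[ℂ] intertwiners θ (A.adRepF (n - 1)) :=
      { toFun := fun f => ⟨
          { toFun := fun v => ⟨f.1.1 v, hker f.1 f.2 v⟩
            map_add' := fun v w => Subtype.ext (by simp)
            map_smul' := fun c v => Subtype.ext (by simp) },
          fun x v => Subtype.ext (congrArg (fun b : A.F n => (b : D)) (f.1.2 x v))⟩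
        map_add' := fun f g => rfl
        map_smul' := fun c f => rfl }
    have hκ : Function.Injective κ := by
      intro f g hfg
      refine Subtype.ext (Subtype.ext (LinearMap.ext fun v => Subtype.ext ?_))
      exact congrArg (fun b : A.F (n - 1) => (b : D))
        (LinearMap.congr_fun (congrArg Subtype.val hfg) v)
    exact finiteDimensional_of_injective_ker (K := ℂ) (E := intertwiners θ (A.adRepF n)) (N := Dual ℂ V)
      (E' := intertwiners θ (A.adRepF (n - 1))) ev κ hκ

end PerfectDixmierAlgebra

/-! ### The trace pairing and the orthogonal decomposition of `D`. -/

namespace PerfectDixmierAlgebra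

open Module

variable {d : ℕ} {G : Type*} [TopologicalSpace G] [ChartedSpace (EuclideanSpace ℂ (Fin d)) G]
  [Group G] [LieGroup 𝓘(ℂ, EuclideanSpace ℂ (Fin d)) ω G] {X : GaloisOrbitCover d G}
  {D : Type*} [Ring D] [Algebra ℂ D] (A : PerfectDixmierAlgebra X D)

theorem T_adRep (x : LieAlg d G) (a : D) : A.T (A.adRep x a) = 0 :=
  A.adRep_eq_zero_of_ρ_invariant A.T A.T_ρ x a

theorem adRep_mul (x : LieAlg d G) (a b : D) :
    A.adRep x (a * b) = A.adRep x a * b + a * A.adRep x b := by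
  simp only [adRep_apply]
  noncomm_ring

theorem T_adRep_mul (x : LieAlg d G) (a b : D) :
    A.T (A.adRep x a * b) = - A.T (a * A.adRep x b) := by
  have := A.T_adRep x (a * b)
  rw [adRep_mul, map_add] at this
  exact eq_neg_of_add_eq_zero_left this

theorem β_one : A.β 1 = 1 := by
  have h : A.β 1 * 1 = 1 := by
    obtain ⟨a, ha⟩ := A.β.surjective 1
    calc A.β 1 * 1 = A.β 1 * A.β a := by rw [ha]
      _ = A.β (a * 1) := (A.β_mul a 1).symm
      _ = 1 := by rw [mul_one, ha]
  rwa [mul_one] at h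

/-- The symbol of `1` multiplies every homogeneous function to itself, and these span `R`. -/
theorem symbol_zero_one : A.symbol 0 ⟨1, A.one_mem_F⟩ = 1 := by
  have h : ∀ n, ∀ f ∈ X.gr n, A.symbol 0 ⟨1, A.one_mem_F⟩ * f = f := by
    intro n f hf
    obtain ⟨a, rfl⟩ := A.exists_symbol_eq hf
    exact (A.symbol_mul (zero_add n).symm ⟨1, A.one_mem_F⟩ a a (one_mul _).symm).symm
  have h' : ∀ f : X.R, A.symbol 0 ⟨1, A.one_mem_F⟩ * f = f := by
    intro f
    have hf : f ∈ ⨆ n, X.gr n := by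
      rw [A.isInternal_gr.submodule_iSup_eq_top]; trivial
    induction hf using Submodule.iSup_induction' with
    | mem n f hf => exact h n f hf
    | zero => rw [mul_zero]
    | add f g _ _ hf hg => rw [mul_add, hf, hg]
  have := h' 1
  rwa [mul_one] at this

theorem one_mem_gr : (1 : X.R) ∈ X.gr 0 := by
  intro m x _
  rw [GaloisOrbitCover.vderiv_eq_dirDeriv]
  change dirDeriv x (fun _ : G => (1 : ℂ)) = _
  rw [dirDeriv_const]
  simp

theorem eq_zero_of_mem_gr_of_mem_gr (A : PerfectDixmierAlgebra X D) {m n : ℤ} (hmn : m ≠ n)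
    {f : X.R} (hm : f ∈ X.gr m) (hn : f ∈ X.gr n) : f = 0 :=
  Submodule.disjoint_def.mp (A.isInternal_gr.submodule_iSupIndep.pairwiseDisjoint hmn) f hm hn

/-! ### Symmetries of the trace pairing -/

/-- The supertrace axioms in a single formula, free of parity assumptions: `β²` absorbs the sign. It
makes left and right orthogonality to filtration spaces equivalent. -/
theorem T_mul_comm (a b : D) : A.T (a * b) = A.T (b * A.β (A.β a)) := by
  -- As `β⁴ = 1`, the elements `(c ± β² c) / 2` are the even and odd parts.
  have split : ∀ c : D, ∃ c₀ c₁, c = c₀ + c₁ ∧ A.β (A.β c₀) = c₀ ∧ A.β (A.β c₁) = -c₁ := by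
    intro c
    refine ⟨(1 / 2 : ℂ) • (c + A.β (A.β c)), (1 / 2 : ℂ) • (c - A.β (A.β c)), ?_, ?_, ?_⟩
    · rw [← smul_add, add_add_sub_cancel, ← two_smul ℂ c, smul_smul]
      norm_num
    · simp only [map_smul, map_add, A.β_four]
      rw [add_comm]
    · simp only [map_smul, map_sub, A.β_four]
      rw [← smul_neg, neg_sub]
  obtain ⟨a₀, a₁, rfl, ha₀, ha₁⟩ := split a
  obtain ⟨b₀, b₁, rfl, hb₀, hb₁⟩ := split b
  have h1 := A.T_even a₀ b₀ ha₀ hb₀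
  have h2 := A.T_odd a₁ b₁ ha₁ hb₁
  have h3 := A.T_mixed a₀ b₁ ha₀ hb₁
  have h4 := A.T_mixed b₀ a₁ hb₀ ha₁
  simp only [map_add, ha₀, ha₁, add_mul, mul_add, mul_neg, map_neg, h1, h2, h3.1, h3.2, h4.1, h4.2]
  ring

theorem β_β_mem_F {n : ℤ} {a : D} (h : a ∈ A.F n) : A.β (A.β a) ∈ A.F n :=
  A.β_mem_F _ _ (A.β_mem_F _ _ h)

theorem β_β_mul (a b : D) : A.β (A.β (a * b)) = A.β (A.β a) * A.β (A.β b) := by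
  rw [A.β_mul, A.β_mul]

theorem β_adRep (x : LieAlg d G) (a : D) : A.β (A.adRep x a) = A.adRep x (A.β a) := by
  simp only [adRep_apply, map_sub, A.β_mul, A.β_ψ, map_neg]
  noncomm_ring

theorem σ_adRep (s : X.S) (x : LieAlg d G) (a : D) :
    A.σ s (A.adRep x a) = A.adRep x (A.σ s a) := by
  simp only [adRep_apply, map_sub, map_mul, A.σ_ψ]

theorem piece_le_F (n : ℤ) : A.piece n ≤ A.F n := fun _ h => h.1

theorem adRep_mem_piece {n : ℤ} {a : D} (h : a ∈ A.piece n) (x : LieAlg d G) :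
    A.adRep x a ∈ A.piece n := by
  refine ⟨A.adRep_mem_F n x a h.1, fun b hb => ?_⟩
  rw [T_adRep_mul, h.2 _ (A.adRep_mem_F _ x b hb), neg_zero]

theorem eq_zero_of_mem_piece_of_mem_F {n m : ℤ} (hmn : m < n) {a : D} (h : a ∈ A.piece n)
    (h' : a ∈ A.F m) : a = 0 :=
  have h'' := A.F_mono (show m ≤ n - 1 by omega) h'
  A.nondegenerate (n - 1) a h'' h.2

theorem T_mul_eq_zero_left {n m : ℤ} (hmn : m < n) {a b : D} (ha : a ∈ A.piece n)
    (hb : b ∈ A.F m) : A.T (a * b) = 0 :=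
  ha.2 b (A.F_mono (show m ≤ n - 1 by omega) hb)

theorem T_mul_eq_zero_right {n m : ℤ} (hmn : m < n) {a b : D} (ha : a ∈ A.piece n)
    (hb : b ∈ A.F m) : A.T (b * a) = 0 := by
  rw [T_mul_comm]
  exact A.T_mul_eq_zero_left hmn ha (A.β_β_mem_F hb)

theorem T_mul_eq_zero_of_ne {n m : ℤ} (hmn : m ≠ n) {a b : D} (ha : a ∈ A.piece n)
    (hb : b ∈ A.piece m) : A.T (a * b) = 0 := by
  rcases lt_or_gt_of_ne hmn with h | h
  · exact A.T_mul_eq_zero_left h ha hb.1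
  · exact A.T_mul_eq_zero_right h hb ha.1

variable [LieAlgebra.IsKilling ℂ (LieAlg d G)] [PreconnectedSpace G]

/-- The symbol of an invariant has zero derivative along all fundamental fields, so it is constant
and of degree `0`. In any other degree it vanishes, which lowers the filtration index. -/
theorem exists_smul_one_of_adRep_eq_zero {a : D} (h : ∀ x, A.adRep x a = 0) :
    ∃ c : ℂ, a = c • 1 := by
  obtain ⟨n, hn⟩ := A.F_exhaustive a
  obtain ⟨k, hk⟩ : ∃ k : ℕ, n < k := ⟨n.toNat + 1, by push_cast; omega⟩
  induction k generalizing n with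
  | zero =>
    rw [A.F_neg n (by exact_mod_cast hk), Submodule.mem_bot] at hn
    exact ⟨0, by rw [hn, zero_smul]⟩
  | succ k ih =>
    set f := A.symbol n ⟨a, hn⟩ with hf
    have hv : ∀ x m, X.vderiv x f m = 0 := by
      intro x m
      have h1 := A.symbol_adRepF_apply n x ⟨a, hn⟩ m
      have h2 : A.adRepF n x ⟨a, hn⟩ = 0 := Subtype.ext (h x)
      rw [h2, map_zero] at h1
      exact neg_eq_zero.mp h1.symm
    have hconst : f = ((f : X.M → ℂ) X.basePoint) • (1 : X.R) := by
      ext m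
      obtain ⟨g, rfl⟩ := X.exists_smul_eq X.basePoint m
      have h1 := (X.hol_orbit f X.basePoint).eq_of_dirDeriv_eq_zero (fun g₀ x => by
        have h2 := hv x (g₀ • X.basePoint)
        rw [GaloisOrbitCover.vderiv_eq_dirDeriv] at h2
        simp only [smul_smul] at h2
        exact h2) g 1
      rw [one_smul] at h1
      change _ = (f : X.M → ℂ) X.basePoint * 1
      rw [mul_one]
      exact h1
    by_cases hn0 : n = 0
    · subst hn0
      set c := (f : X.M → ℂ) X.basePoint
      refine ⟨c, ?_⟩
      have h1 : A.symbol 0 (⟨a, hn⟩ - c • ⟨1, A.one_mem_F⟩) = 0 := by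
        rw [map_sub, map_smul, symbol_zero_one, ← hf, sub_eq_zero]
        exact hconst
      rw [symbol_eq_zero_iff, A.F_neg _ (by norm_num), Submodule.mem_bot] at h1
      exact sub_eq_zero.mp h1
    · have h0 : f = 0 := A.eq_zero_of_mem_gr_of_mem_gr hn0 (A.symbol_mem n _) (by
        rw [hconst]
        exact Submodule.smul_mem _ _ one_mem_gr)
      exact ih (n - 1) (A.symbol_eq_zero_iff.mp h0) (by push_cast at hk; omega)

/-- An invariant functional on `D` is determined by its value at `1`. -/
theorem eq_T_of_invariant (l : Dual ℂ D) (hl : ∀ x a, l (A.adRep x a) = 0) (h1 : l 1 = 1) :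
    l = A.T := by
  by_contra hne
  obtain ⟨v, hv, hv'⟩ := A.isLieRep_adRep.exists_invariant_of_isLocallyFinite
    A.isLocallyFinite_adRep (l - A.T) (fun x a => by
      rw [LinearMap.sub_apply, hl, A.T_adRep, sub_zero]) (sub_ne_zero.mpr hne)
  obtain ⟨c, rfl⟩ := A.exists_smul_one_of_adRep_eq_zero hv
  apply hv'
  rw [map_smul, LinearMap.sub_apply, h1, A.T_one, sub_self, smul_zero]

theorem T_β (a : D) : A.T (A.β a) = A.T a := by
  refine LinearMap.congr_fun (A.eq_T_of_invariant (A.T ∘ₗ A.β.toLinearMap) (fun x a => ?_) ?_) a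
  · change A.T (A.β (A.adRep x a)) = 0
    rw [β_adRep, T_adRep]
  · change A.T (A.β 1) = 1
    rw [β_one, A.T_one]

theorem T_σ (s : X.S) (a : D) : A.T (A.σ s a) = A.T a := by
  refine LinearMap.congr_fun (A.eq_T_of_invariant (A.T ∘ₗ (A.σ s).toLinearMap)
    (fun x a => ?_) ?_) a
  · change A.T (A.σ s (A.adRep x a)) = 0
    rw [σ_adRep, T_adRep]
  · change A.T (A.σ s 1) = 1
    rw [map_one, A.T_one]

/-- `T(β(a) b) = T(β(β³(b) a)) = T(β³(b) a) = 0` for `b` in `F (n - 1)`. -/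
theorem β_mem_piece {n : ℤ} {a : D} (h : a ∈ A.piece n) : A.β a ∈ A.piece n := by
  refine ⟨A.β_mem_F _ _ h.1, fun b hb => ?_⟩
  rw [← A.β_four b, ← A.β_mul, T_β]
  exact A.T_mul_eq_zero_right (sub_one_lt n) h (A.β_mem_F _ _ (A.β_β_mem_F hb))

/-- The symbol axiom gives the equality modulo `F (n - 1)`, and the difference lies in `piece n`,
which meets `F (n - 1)` trivially. -/
theorem β_of_mem_piece {n : ℤ} {a : D} (h : a ∈ A.piece n) : A.β a = Complex.I ^ n • a := by
  have h1 := A.γ_β n ⟨a, h.1⟩ ⟨A.β a, A.β_mem_F _ _ h.1⟩ rfl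
  have h2 : A.symbol n (⟨A.β a, A.β_mem_F _ _ h.1⟩ - Complex.I ^ n • ⟨a, h.1⟩) = 0 := by
    rw [map_sub, map_smul, sub_eq_zero]
    exact h1
  rw [symbol_eq_zero_iff] at h2
  exact sub_eq_zero.mp (A.eq_zero_of_mem_piece_of_mem_F (sub_one_lt n)
    (sub_mem (A.β_mem_piece h) (Submodule.smul_mem _ _ h)) h2)

theorem σ_mem_piece {n : ℤ} {a : D} (h : a ∈ A.piece n) (s : X.S) : A.σ s a ∈ A.piece n := by
  refine ⟨A.σ_mem_F _ _ _ h.1, fun b hb => ?_⟩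
  have h1 : b = A.σ s (A.σ s⁻¹ b) := by
    rw [← AlgEquiv.mul_apply, ← map_mul, mul_inv_cancel, map_one]
    rfl
  rw [h1, ← map_mul, T_σ]
  exact h.2 _ (A.σ_mem_F _ _ _ hb)

/-- Orthogonal projection to `F (n - 1)`: an intertwiner `f` on a finite-dimensional invariant space
containing `a` satisfies `T(ab) = T(f(a) b)` for all `b` in `F (n - 1)`, so `b = f(a)` is
subtracted. -/
theorem exists_sub_mem_piece {n : ℤ} {a : D} (ha : a ∈ A.F n) :
    ∃ b ∈ A.F (n - 1), a - b ∈ A.piece n := by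
  obtain ⟨W, hW, haW, hx, hg⟩ := A.locally_finite a
  have fd : FiniteDimensional ℂ W := Module.Finite.iff_fg.mpr hW
  have hol := A.isHolRep_restrictρ W hg hx
  have fd1 := A.finiteDimensional_intertwiners hol (n - 1)
  have fd2 := A.finiteDimensional_intertwiners hol.dual (n - 1)
  let TT : D →ₗ[ℂ] D →ₗ[ℂ] ℂ := (LinearMap.mul ℂ D).compr₂ A.T
  have hrep := A.isLieRep_adRep.restrict W hx
  obtain ⟨f, -, hf⟩ := exists_intertwiner_eq_pairing hrep hrep.dual (A.isLieRep_adRepF (n - 1))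
    (A.isLocallyFinite_adRepF (n - 1)) (LinearEquiv.refl ℂ (Dual ℂ W)) (fun x u v => rfl)
    (TT.compl₁₂ (A.F (n - 1)).subtype (A.F (n - 1)).subtype)
    (fun x a b => A.T_adRep_mul x a b)
    (fun a h => Subtype.ext (A.nondegenerate (n - 1) a a.2 fun b hb => h ⟨b, hb⟩))
    (TT.compl₁₂ W.subtype (A.F (n - 1)).subtype)
    (fun x a b => A.T_adRep_mul x a b)
  refine ⟨f ⟨a, haW⟩, (f ⟨a, haW⟩).2,
    sub_mem ha (A.F_mono (sub_one_lt n).le (f ⟨a, haW⟩).2), fun b hb => ?_⟩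
  rw [sub_mul, map_sub, sub_eq_zero]
  exact hf ⟨a, haW⟩ ⟨b, hb⟩

/-- The pairing stays nondegenerate on `piece n`, since `a` is already orthogonal to the complement
`F (n - 1)`. -/
theorem eq_zero_of_mem_piece {n : ℤ} {a : D} (h : a ∈ A.piece n)
    (h' : ∀ c ∈ A.piece n, A.T (a * c) = 0) : a = 0 := by
  refine A.nondegenerate n a h.1 fun b hb => ?_
  obtain ⟨c, hc, hbc⟩ := A.exists_sub_mem_piece hb
  have h1 := h' _ hbc
  rwa [mul_sub, map_sub, h.2 c hc, sub_zero] at h1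

theorem F_le_iSup_piece (n : ℤ) : A.F n ≤ ⨆ i : {i : ℤ // i ≤ n}, A.piece i := by
  obtain ⟨k, hk⟩ : ∃ k : ℕ, n < k := ⟨n.toNat + 1, by push_cast; omega⟩
  induction k generalizing n with
  | zero => rw [A.F_neg n (by exact_mod_cast hk)]; exact bot_le
  | succ k ih =>
    intro a ha
    obtain ⟨b, hb, hab⟩ := A.exists_sub_mem_piece ha
    rw [← sub_add_cancel a b]
    refine add_mem (Submodule.mem_iSup_of_mem (⟨n, le_refl n⟩ : {i : ℤ // i ≤ n}) hab) ?_
    have h1 := ih (n - 1) (by push_cast at hk; omega) hb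
    refine (iSup_le fun i => ?_ :
      (⨆ i : {i : ℤ // i ≤ n - 1}, A.piece i) ≤ ⨆ i : {i : ℤ // i ≤ n}, A.piece i) h1
    exact le_iSup (fun i : {i : ℤ // i ≤ n} => A.piece i) ⟨i, by have := i.2; omega⟩

theorem isInternal_piece : DirectSum.IsInternal A.piece := by
  rw [DirectSum.isInternal_submodule_iff_iSupIndep_and_iSup_eq_top]
  constructor
  · intro n
    rw [Submodule.disjoint_def]
    intro a ha ha'
    refine A.eq_zero_of_mem_piece ha fun c hc => ?_
    -- An element of `piece n` that lies in the sum of the other pieces is orthogonal to `piece n`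
    -- itself.
    have h1 : (⨆ j, ⨆ (_ : j ≠ n), A.piece j) ≤ LinearMap.ker (A.T ∘ₗ LinearMap.mulRight ℂ c) :=
      iSup₂_le fun j hj b hb => A.T_mul_eq_zero_of_ne hj.symm hb hc
    exact h1 ha'
  · rw [eq_top_iff]
    intro a _
    obtain ⟨n, hn⟩ := A.F_exhaustive a
    exact (iSup_le fun i => le_iSup A.piece (i : ℤ) :
      (⨆ i : {i : ℤ // i ≤ n}, A.piece i) ≤ _) (A.F_le_iSup_piece n hn)

/-- Membership in a sum of pieces is detected by the trace pairing. -/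
theorem mem_iSup_piece (p : ℤ → Prop) {a : D}
    (h : ∀ n, ¬ p n → ∀ c ∈ A.piece n, A.T (a * c) = 0) :
    a ∈ ⨆ n : {n : ℤ // p n}, A.piece n := by
  obtain ⟨v, rfl⟩ := A.isInternal_piece.surjective a
  have key : ∀ (v : ⨁ n, A.piece n) (n : ℤ), ∀ c ∈ A.piece n,
      A.T (DirectSum.coeAddMonoidHom A.piece v * c) = A.T (v n * c) := by
    intro v n c hc
    induction v using DirectSum.induction_on with
    | zero => simp
    | of i a =>
      rw [DirectSum.coeAddMonoidHom_of]
      by_cases hin : i = n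
      · subst hin
        rw [DirectSum.of_eq_same]
      · rw [DirectSum.of_eq_of_ne _ _ _ (Ne.symm hin), A.T_mul_eq_zero_of_ne (Ne.symm hin) a.2 hc]
        simp
    | add v w hv hw =>
      rw [map_add, add_mul, map_add, hv, hw, DirectSum.add_apply, Submodule.coe_add, add_mul,
        map_add]
  classical
  rw [DirectSum.coeAddMonoidHom_eq_dfinsuppSum]
  refine Submodule.sum_mem _ fun n _ => ?_
  by_cases hp : p n
  · exact Submodule.mem_iSup_of_mem (⟨n, hp⟩ : {n : ℤ // p n}) (v n).2
  · have h0 : (v n : D) = 0 := A.eq_zero_of_mem_piece (v n).2 fun c hc => by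
      rw [← key v n c hc]
      exact h n hp c hc
    change (v n : D) ∈ _
    rw [h0]
    exact zero_mem _

end PerfectDixmierAlgebra

/-! ### The quantization map: existence, uniqueness and equivariance. -/

namespace PerfectDixmierAlgebra

open Module

variable {d : ℕ} {G : Type*} [TopologicalSpace G] [ChartedSpace (EuclideanSpace ℂ (Fin d)) G]
  [Group G] [LieGroup 𝓘(ℂ, EuclideanSpace ℂ (Fin d)) ω G] {X : GaloisOrbitCover d G}
  {D : Type*} [Ring D] [Algebra ℂ D] (A : PerfectDixmierAlgebra X D)
  [LieAlgebra.IsKilling ℂ (LieAlg d G)] [PreconnectedSpace G]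

/-- The symbol map identifies the pieces of `D` with the homogeneous components of `R`. -/
noncomputable def pieceEquiv (n : ℤ) : A.piece n ≃ₗ[ℂ] X.gr n :=
  LinearEquiv.ofBijective
    ((A.symbol n ∘ₗ Submodule.inclusion (A.piece_le_F n)).codRestrict (X.gr n)
      (fun a => A.symbol_mem n _)) (by
    constructor
    · refine (injective_iff_map_eq_zero _).mpr fun a ha => ?_
      have h1 : A.symbol n ⟨a, a.2.1⟩ = 0 := congrArg Subtype.val ha
      rw [symbol_eq_zero_iff] at h1
      exact Subtype.ext (A.eq_zero_of_mem_piece_of_mem_F (sub_one_lt n) a.2 h1)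
    · rintro ⟨f, hf⟩
      obtain ⟨a, rfl⟩ := A.exists_symbol_eq hf
      obtain ⟨b, hb, hab⟩ := A.exists_sub_mem_piece a.2
      refine ⟨⟨a - b, hab⟩, Subtype.ext ?_⟩
      have hbn : b ∈ A.F n := A.F_mono (sub_one_lt n).le hb
      have h1 : A.symbol n (a - ⟨b, hbn⟩) = A.symbol n a := by
        rw [map_sub, (A.symbol_eq_zero_iff (a := ⟨b, hbn⟩)).mpr hb, sub_zero]
      exact h1)

/-- The quantization map `R → D`. -/
noncomputable def quantization : X.R ≃ₗ[ℂ] D :=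
  (LinearEquiv.ofBijective (DirectSum.coeLinearMap X.gr) A.isInternal_gr).symm ≪≫ₗ
    DFinsupp.mapRange.linearEquiv (fun n => (A.pieceEquiv n).symm) ≪≫ₗ
    LinearEquiv.ofBijective (DirectSum.coeLinearMap A.piece) A.isInternal_piece

theorem quantization_pieceEquiv {n : ℤ} (a : A.piece n) :
    A.quantization (A.pieceEquiv n a) = a := by
  have h1 : (LinearEquiv.ofBijective (DirectSum.coeLinearMap X.gr) A.isInternal_gr).symm
      (A.pieceEquiv n a) = DFinsupp.single n (A.pieceEquiv n a) := by
    rw [LinearEquiv.symm_apply_eq]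
    exact (DirectSum.coeLinearMap_lof X.gr n _).symm
  rw [quantization, LinearEquiv.trans_apply, LinearEquiv.trans_apply, h1,
    DFinsupp.mapRange.linearEquiv_apply, DFinsupp.mapRange_single, LinearEquiv.symm_apply_apply]
  exact DirectSum.coeLinearMap_lof A.piece n a

theorem quantization_symm_of_mem_piece {n : ℤ} {a : D} (h : a ∈ A.piece n) :
    A.quantization.symm a = A.symbol n ⟨a, h.1⟩ := by
  rw [LinearEquiv.symm_apply_eq]
  exact (A.quantization_pieceEquiv ⟨a, h⟩).symm

theorem quantization_mem_piece {n : ℤ} {f : X.R} (hf : f ∈ X.gr n) :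
    A.quantization f ∈ A.piece n := by
  obtain ⟨a, ha⟩ := (A.pieceEquiv n).surjective ⟨f, hf⟩
  have h := A.quantization_pieceEquiv a
  rw [ha] at h
  exact h ▸ a.2

theorem symbol_quantization {n : ℤ} {f : X.R} (hf : f ∈ X.gr n) :
    A.symbol n ⟨A.quantization f, (A.quantization_mem_piece hf).1⟩ = f := by
  rw [← A.quantization_symm_of_mem_piece (A.quantization_mem_piece hf),
    LinearEquiv.symm_apply_apply]

theorem quantization_symm_mem_gr {n : ℤ} {a : D} (h : a ∈ A.piece n) :
    A.quantization.symm a ∈ X.gr n := by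
  rw [A.quantization_symm_of_mem_piece h]
  exact A.symbol_mem n _

theorem isQuantizationMap_quantization : A.IsQuantizationMap A.quantization.toLinearMap where
  lifts n f hf := ⟨(A.quantization_mem_piece hf).1, by
    rw [LinearEquiv.eq_symm_apply]
    exact A.symbol_quantization hf⟩
  maps_onto n := by
    ext a
    constructor
    · rintro ⟨f, hf, rfl⟩
      exact A.quantization_mem_piece hf
    · intro h
      exact ⟨_, A.quantization_symm_mem_gr h, A.quantization.apply_symm_apply a⟩

theorem linearMap_ext_gr (A : PerfectDixmierAlgebra X D) {N : Type*} [AddCommGroup N] [Module ℂ N]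
    {p q : X.R →ₗ[ℂ] N} (h : ∀ n, ∀ f ∈ X.gr n, p f = q f) : p = q := by
  ext f
  have hf : f ∈ ⨆ n, X.gr n := by
    rw [A.isInternal_gr.submodule_iSup_eq_top]; trivial
  have h1 : (⨆ n, X.gr n) ≤ LinearMap.eqLocus p q := iSup_le fun n f hf => h n f hf
  exact h1 hf

theorem linearMap_ext_piece {N : Type*} [AddCommGroup N] [Module ℂ N]
    {p q : D →ₗ[ℂ] N} (h : ∀ n, ∀ a ∈ A.piece n, p a = q a) : p = q := by
  ext a
  have ha : a ∈ ⨆ n, A.piece n := by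
    rw [A.isInternal_piece.submodule_iSup_eq_top]; trivial
  have h1 : (⨆ n, A.piece n) ≤ LinearMap.eqLocus p q := iSup_le fun n a ha => h n a ha
  exact h1 ha

/-- The value at a homogeneous `f` is an element of `piece n` with symbol `f`, and symbols are
injective on pieces. -/
theorem IsQuantizationMap.eq_quantization {q : X.R →ₗ[ℂ] D} (hq : A.IsQuantizationMap q) :
    q = A.quantization.toLinearMap := by
  refine linearMap_ext_gr A fun n f hf => ?_
  obtain ⟨h, hl⟩ := hq.lifts n f hf
  have hp : q f ∈ A.piece n := by
    rw [← hq.maps_onto n]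
    exact ⟨f, hf, rfl⟩
  have h1 : A.symbol n ⟨q f, h⟩ = f := by
    rw [symbol_apply, hl, LinearEquiv.apply_symm_apply]
  change q f = A.quantization f
  rw [← LinearEquiv.symm_apply_eq, A.quantization_symm_of_mem_piece hp]
  exact h1

theorem one_mem_piece : (1 : D) ∈ A.piece 0 := by
  refine ⟨A.one_mem_F, fun b hb => ?_⟩
  rw [A.F_neg _ (by norm_num), Submodule.mem_bot] at hb
  rw [hb, mul_zero, map_zero]

theorem quantization_one : A.quantization 1 = 1 := by
  rw [← LinearEquiv.eq_symm_apply, A.quantization_symm_of_mem_piece A.one_mem_piece,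
    symbol_zero_one]

theorem quantization_symm_adRep (x : LieAlg d G) (a : D) (m : X.M) :
    (A.quantization.symm (A.adRep x a) : X.M → ℂ) m =
      - X.vderiv x (A.quantization.symm a : X.R) m := by
  have h : X.evalL m ∘ₗ A.quantization.symm.toLinearMap ∘ₗ A.adRep x =
      - (X.vderivL x m ∘ₗ A.quantization.symm.toLinearMap) := by
    refine A.linearMap_ext_piece fun n a ha => ?_
    change (A.quantization.symm (A.adRep x a) : X.M → ℂ) m =
      - X.vderiv x (A.quantization.symm a : X.R) m
    rw [A.quantization_symm_of_mem_piece ha,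
      A.quantization_symm_of_mem_piece (A.adRep_mem_piece ha x)]
    exact A.symbol_adRepF_apply n x ⟨a, ha.1⟩ m
  exact LinearMap.congr_fun h a

/-- Infinitesimal equivariance integrates over the connected group on a finite-dimensional invariant
subspace containing `a`. -/
theorem quantization_symm_ρ (g : G) (a : D) :
    A.quantization.symm (A.ρ g a) = X.actG g (A.quantization.symm a) := by
  obtain ⟨W, hW, haW, hx, hg⟩ := A.locally_finite a
  have fd : FiniteDimensional ℂ W := Module.Finite.iff_fg.mpr hW
  ext m
  have h := X.apply_smul_of_infinitesimally_equivariant (A.isHolRep_restrictρ W hg hx)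
    (A.quantization.symm.toLinearMap ∘ₗ W.subtype)
    (fun x v m => A.quantization_symm_adRep x v m) g ⟨a, haW⟩ (g⁻¹ • m)
  rw [smul_inv_smul] at h
  exact h

theorem quantization_actG (g : G) (f : X.R) :
    A.quantization (X.actG g f) = A.ρ g (A.quantization f) := by
  rw [← LinearEquiv.eq_symm_apply, quantization_symm_ρ, LinearEquiv.symm_apply_apply]

theorem quantization_actS (s : X.S) (f : X.R) :
    A.quantization (X.actS s f) = A.σ s (A.quantization f) := by
  let L : X.R →ₗ[ℂ] X.R :=
    { toFun := X.actS s
      map_add' := fun _ _ => rfl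
      map_smul' := fun _ _ => rfl }
  have h : A.quantization.toLinearMap ∘ₗ L =
      (A.σ s).toLinearMap ∘ₗ A.quantization.toLinearMap := by
    refine linearMap_ext_gr A fun n f hf => ?_
    change A.quantization (X.actS s f) = A.σ s (A.quantization f)
    have hp := A.quantization_mem_piece hf
    rw [← LinearEquiv.eq_symm_apply, A.quantization_symm_of_mem_piece (A.σ_mem_piece hp s)]
    have h1 := A.γ_σ s n ⟨A.quantization f, hp.1⟩ ⟨A.σ s (A.quantization f), A.σ_mem_F _ _ _ hp.1⟩
      rfl
    refine Eq.trans ?_ h1.symm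
    exact congrArg (X.actS s) (A.symbol_quantization hf).symm
  exact LinearMap.congr_fun h f

theorem quantization_circ (f g : X.R) :
    A.quantization (circ A.quantization f g) = A.quantization f * A.quantization g :=
  A.quantization.apply_symm_apply _

/-- If `D` were commutative, the embedded Lie algebra would be abelian, but its center is zero. -/
theorem exists_mul_ne_mul [Nontrivial (LieAlg d G)] (A : PerfectDixmierAlgebra X D) :
    ∃ a b : D, a * b ≠ b * a := by
  by_contra! h
  obtain ⟨x, hx⟩ := exists_ne (0 : LieAlg d G)
  have hc : x ∈ LieAlgebra.center ℂ (LieAlg d G) := by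
    rw [LieModule.mem_maxTrivSubmodule]
    intro y
    apply A.ψ_injective
    rw [A.ψ_lie, h, sub_self, map_zero]
  rw [LieAlgebra.center_eq_bot] at hc
  exact hx (by simpa using hc)

end PerfectDixmierAlgebra

/-! ### The product: degrees, leading terms and parity. -/

namespace PerfectDixmierAlgebra

open Module

variable {d : ℕ} {G : Type*} [TopologicalSpace G] [ChartedSpace (EuclideanSpace ℂ (Fin d)) G]
  [Group G] [LieGroup 𝓘(ℂ, EuclideanSpace ℂ (Fin d)) ω G] {X : GaloisOrbitCover d G}
  {D : Type*} [Ring D] [Algebra ℂ D] (A : PerfectDixmierAlgebra X D)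
  [LieAlgebra.IsKilling ℂ (LieAlg d G)] [PreconnectedSpace G]

theorem β_β_of_mem_piece {n : ℤ} {a : D} (h : a ∈ A.piece n) :
    A.β (A.β a) = ((-1 : ℂ) ^ n) • a := by
  rw [A.β_of_mem_piece h, map_smul, A.β_of_mem_piece h, smul_smul, ← mul_zpow, Complex.I_mul_I]

theorem β_mul_of_mem_piece {j k : ℤ} {a b : D} (ha : a ∈ A.piece j) (hb : b ∈ A.piece k) :
    A.β (a * b) = (Complex.I ^ (j + k)) • (b * a) := by
  rw [A.β_mul, A.β_of_mem_piece ha, A.β_of_mem_piece hb, smul_mul_smul_comm,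
    zpow_add₀ Complex.I_ne_zero, mul_comm (Complex.I ^ k)]

/-- `β²` is an automorphism preserving `T`, and it multiplies `abc` by `(-1)^(j+k+n)`. -/
theorem T_mul_mul_eq_zero_of_odd {j k n : ℤ} (hodd : Odd (j + k + n)) {a b c : D}
    (ha : a ∈ A.piece j) (hb : b ∈ A.piece k) (hc : c ∈ A.piece n) : A.T (a * b * c) = 0 := by
  have h : A.T (A.β (A.β (a * b * c))) = A.T (a * b * c) := by rw [A.T_β, A.T_β]
  rw [A.β_β_mul, A.β_β_mul, A.β_β_of_mem_piece ha, A.β_β_of_mem_piece hb,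
    A.β_β_of_mem_piece hc, smul_mul_smul_comm, smul_mul_smul_comm, map_smul,
    ← zpow_add₀ (by norm_num), ← zpow_add₀ (by norm_num), hodd.neg_one_zpow, neg_one_smul] at h
  exact self_eq_neg.mp h.symm

/-- Applying `β` gives `i^(n+j+k) T(cba)`, and moving `c` to the right contributes `(-1)^n =
i^(2n)`. The total exponent is `4n + 2p`, which leaves `(-1)^p`. -/
theorem T_mul_mul_swap {j k n : ℤ} (p : ℕ) (hn : n = j + k - 2 * p) {a b c : D}
    (ha : a ∈ A.piece j) (hb : b ∈ A.piece k) (hc : c ∈ A.piece n) :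
    A.T (a * b * c) = (-1 : ℂ) ^ p * A.T (b * a * c) := by
  rw [← A.T_β, A.β_mul, A.β_mul_of_mem_piece ha hb, A.β_of_mem_piece hc, smul_mul_smul_comm,
    map_smul, A.T_mul_comm, A.β_β_of_mem_piece hc, mul_smul_comm, map_smul, smul_smul, smul_eq_mul]
  congr 1
  rw [← zpow_add₀ Complex.I_ne_zero, ← Complex.I_mul_I, mul_zpow, ← zpow_add₀ Complex.I_ne_zero,
    ← zpow_add₀ Complex.I_ne_zero, mul_pow, ← pow_add, ← zpow_natCast, hn,
    show j + k - 2 * (p : ℤ) + (j + k) + (j + k - 2 * p + (j + k - 2 * p)) =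
      4 * (j + k - 2 * p) + ((p + p : ℕ) : ℤ) by push_cast; ring,
    zpow_add₀ Complex.I_ne_zero, zpow_mul]
  have h4 : Complex.I ^ (4 : ℤ) = 1 := by exact_mod_cast Complex.I_pow_four
  rw [h4, one_zpow, one_mul]

/-- A component in degree `n` is detected by `T(abc)` with `c` in `piece n`. If one of the degrees
`j`, `k`, `n` exceeds the sum of the other two, the corresponding factor, moved to an end by the
supertrace property, is orthogonal to the product of the others. -/
theorem mul_mem_iSup_piece (j k : ℕ) {a b : D} (ha : a ∈ A.piece j) (hb : b ∈ A.piece k) :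
    a * b ∈ ⨆ p : Fin (min j k + 1), A.piece ((j : ℤ) + k - 2 * (p : ℕ)) := by
  have h := A.mem_iSup_piece (fun n => ∃ p : Fin (min j k + 1), n = (j : ℤ) + k - 2 * (p : ℕ))
    (a := a * b) (fun n hn c hc => by
      rcases Int.even_or_odd ((j : ℤ) + k + n) with he | ho
      · by_cases h1 : (j : ℤ) + k < n
        · exact A.T_mul_eq_zero_right h1 hc (A.mul_mem_F _ _ _ _ ha.1 hb.1)
        by_cases h2 : (k : ℤ) + n < j
        · rw [mul_assoc]
          exact A.T_mul_eq_zero_left h2 ha (A.mul_mem_F _ _ _ _ hb.1 hc.1)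
        by_cases h3 : n + (j : ℤ) < k
        · rw [mul_assoc, A.T_mul_comm, mul_assoc]
          exact A.T_mul_eq_zero_left h3 hb (A.mul_mem_F _ _ _ _ hc.1 (A.β_β_mem_F ha.1))
        refine absurd ?_ hn
        -- From `j + k + n = 2r` one gets `n = j + k - 2p` with `p = j + k - r`. The triangle
        -- inequalities say exactly `0 ≤ p ≤ min j k`.
        obtain ⟨r, hr⟩ := he
        refine ⟨⟨(j + k - r : ℤ).toNat, by omega⟩, ?_⟩
        change n = (j : ℤ) + k - 2 * ((j + k - r : ℤ).toNat : ℕ)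
        omega
      · exact A.T_mul_mul_eq_zero_of_odd ho ha hb hc)
  refine (iSup_le ?_ : _ ≤ ⨆ p : Fin (min j k + 1), A.piece ((j : ℤ) + k - 2 * (p : ℕ))) h
  rintro ⟨_, p, rfl⟩
  exact le_iSup (fun p : Fin (min j k + 1) => A.piece ((j : ℤ) + k - 2 * (p : ℕ))) p

theorem quantization_symm_mem_iSup {ι : Type*} (N : ι → ℤ) {a : D}
    (h : a ∈ ⨆ i, A.piece (N i)) : A.quantization.symm a ∈ ⨆ i, X.gr (N i) := by
  have h1 : (⨆ i, A.piece (N i)) ≤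
      (⨆ i, X.gr (N i)).comap A.quantization.symm.toLinearMap :=
    iSup_le fun i b hb => Submodule.mem_iSup_of_mem i (A.quantization_symm_mem_gr hb)
  exact h1 h

theorem T_quantization_sum_mul {N : ℕ → ℤ} (hN : Function.Injective N) (C : ℕ →₀ X.R)
    (hC : ∀ p, C p ∈ X.gr (N p)) (p : ℕ) {c : D} (hc : c ∈ A.piece (N p)) :
    A.T (A.quantization (C.sum fun _ c => c) * c) = A.T (A.quantization (C p) * c) := by
  rw [Finsupp.sum, map_sum, Finset.sum_mul, map_sum]
  refine Finset.sum_eq_single p (fun i _ hi => ?_) (fun hp => ?_)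
  · exact A.T_mul_eq_zero_of_ne (hN.ne hi.symm) (A.quantization_mem_piece (hC i)) hc
  · rw [Finsupp.notMem_support_iff.mp hp, map_zero, zero_mul, map_zero]

/-- Pairing with `piece (j + k - 2p)` isolates the component `p` of each product, and
`T_mul_mul_swap` compares the two. -/
theorem component_swap {j k : ℤ} {f g : X.R} (hf : f ∈ X.gr j) (hg : g ∈ X.gr k)
    (C C' : ℕ →₀ X.R) (hC : ∀ p, C p ∈ X.gr (j + k - 2 * (p : ℕ)))
    (hC' : ∀ p, C' p ∈ X.gr (j + k - 2 * (p : ℕ)))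
    (h : circ A.quantization f g = C.sum fun _ c => c)
    (h' : circ A.quantization g f = C'.sum fun _ c => c) (p : ℕ) :
    C p = (-1 : ℂ) ^ p • C' p := by
  apply A.quantization.injective
  have hN : Function.Injective fun p : ℕ => j + k - 2 * (p : ℤ) := fun p q hpq => by
    have : j + k - 2 * (p : ℤ) = j + k - 2 * (q : ℤ) := hpq
    omega
  rw [map_smul, ← sub_eq_zero]
  refine A.eq_zero_of_mem_piece (sub_mem (A.quantization_mem_piece (hC p))
    (Submodule.smul_mem _ _ (A.quantization_mem_piece (hC' p)))) fun c hc => ?_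
  have h1 := A.T_quantization_sum_mul hN C hC p hc
  have h2 := A.T_quantization_sum_mul hN C' hC' p hc
  rw [← h, quantization_circ] at h1
  rw [← h', quantization_circ] at h2
  rw [sub_mul, map_sub, smul_mul_assoc, map_smul, ← h1, ← h2, smul_eq_mul,
    A.T_mul_mul_swap p rfl (A.quantization_mem_piece hf) (A.quantization_mem_piece hg) hc, sub_self]

theorem symbol_congr {n : ℤ} {a b : D} (ha : a ∈ A.F n) (hb : b ∈ A.F n)
    (h : a - b ∈ A.F (n - 1)) : A.symbol n ⟨a, ha⟩ = A.symbol n ⟨b, hb⟩ := by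
  rw [← sub_eq_zero, ← map_sub]
  exact A.symbol_eq_zero_iff.mpr h

theorem exists_circ_eq (j k : ℕ) {f g : X.R} (hf : f ∈ X.gr j) (hg : g ∈ X.gr k) :
    ∃ r ∈ X.grLE ((j : ℤ) + k - 4), ((circ A.quantization f g : X.R) : X.M → ℂ) =
      (f : X.M → ℂ) * g + (1 / 2 : ℂ) • X.poisson f g + (r : X.M → ℂ) := by
  have ha := A.quantization_mem_piece hf
  have hb := A.quantization_mem_piece hg
  set a := A.quantization f with ha_def
  set b := A.quantization g with hb_def
  set N : ℤ := (j : ℤ) + k with hN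
  have hab : a * b ∈ A.piece N ⊔ A.piece (N - 2) ⊔
      ⨆ i : {i : ℤ // i ≤ N - 4}, A.piece i := by
    refine (iSup_le fun p => ?_ : (⨆ p : Fin (min j k + 1), A.piece ((j : ℤ) + k - 2 * (p : ℕ))) ≤ _)
      (A.mul_mem_iSup_piece j k ha hb)
    rcases Nat.lt_or_ge (p : ℕ) 2 with hp | hp
    · refine le_trans ?_ le_sup_left
      interval_cases hp' : (p : ℕ)
      · simp [hN]
      · simp [hN]
    · refine le_trans ?_ le_sup_right
      exact le_iSup (fun i : {i : ℤ // i ≤ N - 4} => A.piece i) ⟨(j : ℤ) + k - 2 * (p : ℕ), by omega⟩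
  obtain ⟨w, hw, u₂, hu₂, hu⟩ := Submodule.mem_sup.mp hab
  obtain ⟨u₀, hu₀, u₁, hu₁, rfl⟩ := Submodule.mem_sup.mp hw
  have hu₂F : u₂ ∈ A.F (N - 4) :=
    (iSup_le fun i => (A.piece_le_F i).trans (A.F_mono i.2) :
      (⨆ i : {i : ℤ // i ≤ N - 4}, A.piece i) ≤ _) hu₂
  have hI : Complex.I ^ N ≠ 0 := zpow_ne_zero _ Complex.I_ne_zero
  -- `β(ab) = i^N ba`, while `β` is `i^N` on `u₀` and `i^(N-2) = -i^N` on `u₁`.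
  have hba : b * a = u₀ - u₁ + (Complex.I ^ N)⁻¹ • A.β u₂ := by
    have h1 := A.β_mul_of_mem_piece ha hb
    rw [← hu, map_add, map_add, A.β_of_mem_piece hu₀, A.β_of_mem_piece hu₁,
      zpow_sub₀ Complex.I_ne_zero, show Complex.I ^ (2 : ℤ) = -1 by exact_mod_cast Complex.I_sq] at h1
    rw [← inv_smul_eq_iff₀ hI] at h1
    rw [← h1, smul_add, smul_add, smul_smul, smul_smul, inv_mul_cancel₀ hI]
    rw [show (Complex.I ^ N)⁻¹ * (Complex.I ^ N / -1) = -1 by field_simp]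
    rw [one_smul, neg_one_smul, sub_eq_add_neg]
  -- So `2u₁` is the leading part of the commutator, and its symbol is `{f, g}`.
  have hcomm : a * b - b * a - (2 : ℂ) • u₁ ∈ A.F (N - 2 - 1) := by
    have h1 : a * b - b * a - (2 : ℂ) • u₁ = u₂ - (Complex.I ^ N)⁻¹ • A.β u₂ := by
      rw [hba, ← hu, two_smul]
      abel
    rw [h1]
    exact A.F_mono (show N - 4 ≤ N - 2 - 1 by omega)
      (sub_mem hu₂F (Submodule.smul_mem _ _ (A.β_mem_F _ _ hu₂F)))
  have hlead : a * b - u₀ ∈ A.F (N - 1) := by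
    rw [← hu, show u₀ + u₁ + u₂ - u₀ = u₁ + u₂ by abel]
    exact add_mem (A.F_mono (show N - 2 ≤ N - 1 by omega) hu₁.1)
      (A.F_mono (show N - 4 ≤ N - 1 by omega) hu₂F)
  have habF : a * b ∈ A.F N := A.mul_mem_F _ _ _ _ ha.1 hb.1
  have hcF : a * b - b * a ∈ A.F (N - 2) := A.commutator_mem_F _ _ _ _ ha.1 hb.1
  have e₀ : A.quantization.symm u₀ = f * g := by
    rw [A.quantization_symm_of_mem_piece hu₀, ← A.symbol_congr habF hu₀.1 hlead,
      A.symbol_mul hN ⟨a, ha.1⟩ ⟨b, hb.1⟩ ⟨a * b, habF⟩ rfl]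
    exact congrArg₂ (· * ·) (A.symbol_quantization hf) (A.symbol_quantization hg)
  have e₁ : (((2 : ℂ) • A.quantization.symm u₁ : X.R) : X.M → ℂ) = X.poisson f g := by
    have h1 := A.symbol_poisson (by rw [hN]) ⟨a, ha.1⟩ ⟨b, hb.1⟩ ⟨a * b - b * a, hcF⟩ rfl
    rw [A.symbol_congr hcF (Submodule.smul_mem _ _ hu₁.1) hcomm] at h1
    have h2 : A.symbol j ⟨a, ha.1⟩ = f := A.symbol_quantization hf
    have h3 : A.symbol k ⟨b, hb.1⟩ = g := A.symbol_quantization hg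
    rw [h2, h3] at h1
    rw [← h1, ← map_smul, A.quantization_symm_of_mem_piece (Submodule.smul_mem _ _ hu₁)]
  refine ⟨A.quantization.symm u₂,
    A.quantization_symm_mem_iSup (fun i : {i : ℤ // i ≤ N - 4} => (i : ℤ)) hu₂, ?_⟩
  have hc : circ A.quantization f g = A.quantization.symm (a * b) := rfl
  rw [hc, ← hu, map_add, map_add, e₀, ← e₁]
  funext m
  change (f : X.M → ℂ) m * (g : X.M → ℂ) m + (A.quantization.symm u₁ : X.M → ℂ) m + _ =
    (f : X.M → ℂ) m * (g : X.M → ℂ) m +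
      (1 / 2 : ℂ) * (2 * (A.quantization.symm u₁ : X.M → ℂ) m) + _
  ring

end PerfectDixmierAlgebra

theorem proposition4p1 {d : ℕ} {G : Type*} [TopologicalSpace G]
    [ChartedSpace (EuclideanSpace ℂ (Fin d)) G] [Group G]
    [LieGroup 𝓘(ℂ, EuclideanSpace ℂ (Fin d)) ω G] [SimplyConnectedSpace G]
    [LieAlgebra.IsSemisimple ℂ (LieAlg d G)]
    (X : GaloisOrbitCover d G) {D : Type*} [Ring D] [Algebra ℂ D]
    (A : PerfectDixmierAlgebra X D) :
    -- the quantization map exists, is unique, and is a linear isomorphism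
    ∃ q : X.R ≃ₗ[ℂ] D,
      A.IsQuantizationMap q.toLinearMap ∧
      (∀ q' : X.R →ₗ[ℂ] D, A.IsQuantizationMap q' → q' = q.toLinearMap) ∧
      -- the product is associative and unital, and noncommutative unless the Lie algebra is zero
      (∀ f g h : X.R, circ q (circ q f g) h = circ q f (circ q g h)) ∧
      (∀ f : X.R, circ q 1 f = f ∧ circ q f 1 = f) ∧
      (Nontrivial (LieAlg d G) → ∃ f g : X.R, circ q f g ≠ circ q g f) ∧
      -- the product is invariant under `G × S`
      (∀ (a : G) (f g : X.R), X.actG a (circ q f g) = circ q (X.actG a f) (X.actG a g)) ∧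
      (∀ (s : X.S) (f g : X.R), X.actS s (circ q f g) = circ q (X.actS s f) (X.actS s g)) ∧
      -- the Euler grading is a direct sum decomposition of `R`
      DirectSum.IsInternal X.gr ∧
      -- homogeneous elements, of degrees `j / 2` and `k / 2`
      ∀ (j k : ℕ) (f g : X.R), f ∈ X.gr j → g ∈ X.gr k →
        -- the components of the product lie in the degrees `(j + k) / 2 - p ≥ |j - k| / 2`
        circ q f g ∈ ⨆ p : Fin (min j k + 1), X.gr ((j : ℤ) + k - 2 * (p : ℕ)) ∧
        (∃ r ∈ X.grLE ((j : ℤ) + k - 4),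
          ((circ q f g : X.R) : X.M → ℂ) =
            (f : X.M → ℂ) * g + (1 / 2 : ℂ) • X.poisson f g + (r : X.M → ℂ)) ∧
        -- `C p` and `C' p` are the components of degree `(j + k) / 2 - p` of the two products
        ∀ C C' : ℕ →₀ X.R,
          (∀ p, C p ∈ X.gr ((j : ℤ) + k - 2 * (p : ℕ))) →
          (∀ p, C' p ∈ X.gr ((j : ℤ) + k - 2 * (p : ℕ))) →
          circ q f g = C.sum (fun _ c => c) →
          circ q g f = C'.sum (fun _ c => c) →
          ∀ p, C p = (-1 : ℂ) ^ p • C' p := by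
  have : PreconnectedSpace G := inferInstance
  have : LieAlgebra.IsKilling ℂ (LieAlg d G) := inferInstance
  refine ⟨A.quantization, A.isQuantizationMap_quantization, fun q' hq' => hq'.eq_quantization,
    fun f g h => ?_, fun f => ⟨?_, ?_⟩, fun hn => ?_, fun a f g => ?_, fun s f g => ?_,
    A.isInternal_gr, fun j k f g hf hg => ⟨?_, A.exists_circ_eq j k hf hg,
      fun C C' hC hC' h h' p => A.component_swap hf hg C C' hC hC' h h' p⟩⟩
  · apply A.quantization.injective
    simp only [PerfectDixmierAlgebra.quantization_circ, mul_assoc]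
  · apply A.quantization.injective
    rw [A.quantization_circ, A.quantization_one, one_mul]
  · apply A.quantization.injective
    rw [A.quantization_circ, A.quantization_one, mul_one]
  · obtain ⟨a, b, hab⟩ := A.exists_mul_ne_mul
    refine ⟨A.quantization.symm a, A.quantization.symm b, fun h => hab ?_⟩
    have h' := congrArg A.quantization h
    rwa [A.quantization_circ, A.quantization_circ, LinearEquiv.apply_symm_apply,
      LinearEquiv.apply_symm_apply] at h'
  · apply A.quantization.injective
    simp only [PerfectDixmierAlgebra.quantization_circ, PerfectDixmierAlgebra.quantization_actG,
      map_mul]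
  · apply A.quantization.injective
    simp only [PerfectDixmierAlgebra.quantization_circ, PerfectDixmierAlgebra.quantization_actS,
      map_mul]
  · exact A.quantization_symm_mem_iSup _ (A.mul_mem_iSup_piece j k
      (A.quantization_mem_piece hf) (A.quantization_mem_piece hg))
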